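/- Let $0<a\le 1$ and $0<\alpha<1$, and let $$P(z)=\begin{pmatrix}\alpha & a\alpha z\\ \frac a\alpha & \frac1\alpha\end{pmatrix}\begin{pmatrix}1&a\\ \frac az&1\end{pmatrix}.$$ Let $\mathcal E$ be the real elliptic curve $$y^2=x^2+\frac{4x(x-a^2)(x-a^{-2})}{(a+1/a)^2(\alpha+1/\alpha)^2}$$ with its chord–tangent group law (the point at infinity being the identity), let $\sigma(x,y)=(x,y)+(a^{-2},a^{-2})$ and let $(x_k,y_k)=\sigma^k\big(-1,-\tfrac{1-\alpha^2}{1+\alpha^2}\big)$ for $k\ge0$. Put $$a(x,y)=\tfrac{a(a^2+1)(\alpha^2+1)}2\,\tfrac{y-x}{1-a^2x},\qquad b(x,y)=-\tfrac1{\alpha a x},\qquad d(x,y)=\tfrac{2a\alpha x(x-a^{-2})}{(a^2+1)(\alpha+1/\alpha)(y-x)},$$ $$\mathcal P_-(x,y)(z)=b(x,y)\begin{pmatrix}a(x,y)&0\\0&1\end{pmatrix}\begin{pmatrix}1&1\\ \frac{a^2}z&1\end{pmatrix}\begin{pmatrix}1&0\\0&a(x,y)\end{pmatrix},$$ $$\mathcal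 P_+(x,y)(z)=\begin{pmatrix}1&0\\0&\frac{a^2}{\alpha^2}d(x,y)\end{pmatrix}\begin{pmatrix}1&a^2z\\1&1\end{pmatrix}\begin{pmatrix}1&0\\0&d(x,y)\end{pmatrix},$$ and $P_{k,\pm}=\mathcal P_\pm(x_k,y_k)$. Assume that $(a^{-2},a^{-2})$ is a torsion point of $\mathcal E$ of finite order $d\ge1$, and set $$P_-^{(d)}=P_{0,-}P_{1,-}\cdots P_{d-1,-},\qquad P_+^{(d)}=P_{d-1,+}\cdots P_{1,+}P_{0,+}.$$ Let $R(z)=(\alpha+\frac1\alpha)^2(1+a^2)^2-4(1-a^2z)(1-\frac{a^2}z)$, with zeros $x_1<x_2<0$, and let $\mathcal R$ be the compact Riemann surface of $R(z)^{1/2}$ (equivalently, of $\det(P(z)-\lambda)=0$): two copies of $\mathbb C\setminus((-\infty,x_1]\cup[x_2,0])$ glued crosswise along the cuts, with branch points $x_1,x_2,0,\infty$. Write $z^{(1)},z^{(2)}$ for the points over $z$ on the first and second sheet, where $R(z)^{1/2}>0$ for $z>0$ on the first sheet, and let $$\lambda=\tfrac12\big(\alpha+\tfrac1\alpha\big)(1+a^2)+\tfrac12R^{1/2}$$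 on $\mathcal R$. Then there are meromorphic functions $\mu,\nu$ on $\mathcal R$ such that the following holds. 1. At every point of $\mathcal R$ lying over some $z\in\mathbb C\setminus\{0\}$, $\mu$ and $\nu$ are finite, $\det(P_-^{(d)}(z)-\mu)=0$, $\det(P_+^{(d)}(z)-\nu)=0$ and $\lambda^d=\mu\nu$. 2. $\mu$ has a zero of order $d$ at $(a^2)^{(2)}$, a pole of order $d$ at $0$, and no other zeros or poles; $\nu$ has a zero of order $d$ at $(a^{-2})^{(2)}$, a pole of order $d$ at $\infty$, and no other zeros or poles. (Orders are taken in a local coordinate of $\mathcal R$.) 3. For $z\in\mathbb C\setminus((-\infty,x_1]\cup[x_2,0])$, $z\neq-1$, write $\lambda_j(z)=\lambda(z^{(j)})$, $\mu_j(z)=\mu(z^{(j)})$, $\nu_j(z)=\nu(z^{(j)})$. Then the matrix $$E(z)=\begin{pmatrix}a\alpha(1+z)&a\alpha(1+z)\\ \lambda_1(z)-\alpha(a^2+1)&\lambda_2(z)-\alpha(a^2+1)\end{pmatrix}$$ is invertible, and $$P(z)=E(z)\begin{pmatrix}\lambda_1(z)&0\\0&\lambda_2(z)\end{pmatrix}E(z)^{-1},\quad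 P_-^{(d)}(z)=E(z)\begin{pmatrix}\mu_1(z)&0\\0&\mu_2(z)\end{pmatrix}E(z)^{-1},\quad P_+^{(d)}(z)=E(z)\begin{pmatrix}\nu_1(z)&0\\0&\nu_2(z)\end{pmatrix}E(z)^{-1}.$$ -/

import Mathlib

/-! Meromorphic functions on a one-dimensional complex manifold. -/

/-- `f` is a meromorphic function on the complex curve `X`: read in the chart at any point, it is
meromorphic there.  Normal form only fixes the values: `f` takes its analytic value wherever it has
no pole, and the (meaningless) value at a pole is `0`. -/
def IsMeromorphicFunction {X : Type*} [TopologicalSpace X] [ChartedSpace ℂ X] (f : X → ℂ) : Prop :=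
  ∀ p : X, MeromorphicNFAt (f ∘ (chartAt ℂ p).symm) (chartAt ℂ p p)

/-- The order of `f` at `p` in a local coordinate: `n > 0` for a zero of order `n`, `-n < 0` for a
pole of order `n`. -/
noncomputable def orderAtPoint {X : Type*} [TopologicalSpace X] [ChartedSpace ℂ X]
    (f : X → ℂ) (p : X) : WithTop ℤ :=
  meromorphicOrderAt (f ∘ (chartAt ℂ p).symm) (chartAt ℂ p p)

/-- The parameters `a ∈ (0,1]` and `α ∈ (0,1)` of the biased doubly periodic Aztec diamond. -/
structure AztecParams where
  a : ℝ
  α : ℝ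
  a_pos : 0 < a
  a_le_one : a ≤ 1
  α_pos : 0 < α
  α_lt_one : α < 1

namespace AztecParams

open Complex Topology Filter OnePoint

noncomputable section

variable (M : AztecParams)

/-! ### The matrix symbol -/

/-- The matrix `P(z)`. -/
def P (z : ℂ) : Matrix (Fin 2) (Fin 2) ℂ :=
  !![(M.α : ℂ), M.a * M.α * z; M.a / M.α, 1 / M.α] * !![1, (M.a : ℂ); M.a / z, 1]

/-! ### The elliptic curve `y² = x² + 4x(x-a²)(x-a⁻²) / ((a+1/a)²(α+1/α)²)` and its flow -/

/-- `κ = (a + 1/a)(α + 1/α)/2`. -/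
def kappa : ℝ := (M.a + 1 / M.a) * (M.α + 1 / M.α) / 2

/-- The elliptic curve in Weierstrass form: the linear change of variables `X = x`, `Y = κ y`
turns the equation above into `Y² = X³ + (κ² - a² - a⁻²) X² + X` (see `equation_iff_paper`); being
linear, it respects the chord and tangent addition, with the point at infinity as identity. -/
def ellipticCurve : WeierstrassCurve.Affine ℝ where
  a₁ := 0
  a₂ := M.kappa ^ 2 - M.a ^ 2 - 1 / M.a ^ 2
  a₃ := 0
  a₄ := 1
  a₆ := 0

lemma kappa_pos : 0 < M.kappa := by
  have := M.a_pos
  have := M.α_pos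
  unfold kappa
  positivity

lemma equation_iff_paper (x y : ℝ) : M.ellipticCurve.Equation x (M.kappa * y) ↔
    y ^ 2 = x ^ 2 + 4 * x * (x - M.a ^ 2) * (x - 1 / M.a ^ 2) /
      ((M.a + 1 / M.a) ^ 2 * (M.α + 1 / M.α) ^ 2) := by
  have hk := M.kappa_pos
  have ha := M.a_pos.ne'
  have hden : (M.a + 1 / M.a) ^ 2 * (M.α + 1 / M.α) ^ 2 = 4 * M.kappa ^ 2 := by
    unfold kappa; ring
  rw [hden, WeierstrassCurve.Affine.equation_iff]
  simp only [ellipticCurve]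
  rw [← mul_right_inj' (pow_ne_zero 2 hk.ne') (b := y ^ 2)]
  have : M.kappa ^ 2 * (x ^ 2 + 4 * x * (x - M.a ^ 2) * (x - 1 / M.a ^ 2) / (4 * M.kappa ^ 2))
      = x ^ 3 + (M.kappa ^ 2 - M.a ^ 2 - 1 / M.a ^ 2) * x ^ 2 + 1 * x + 0 := by
    field_simp
    ring
  rw [this]
  constructor <;> intro h <;> linarith

lemma nonsingular_of_ne {x y : ℝ} (hy : y ≠ 0) (h : M.ellipticCurve.Equation x y) :
    M.ellipticCurve.Nonsingular x y := by
  rw [WeierstrassCurve.Affine.nonsingular_iff']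
  exact ⟨h, Or.inr (by simpa [ellipticCurve] using hy)⟩

lemma nonsingular_shift :
    M.ellipticCurve.Nonsingular (1 / M.a ^ 2) (M.kappa * (1 / M.a ^ 2)) := by
  have ha := M.a_pos
  have hk := M.kappa_pos
  refine M.nonsingular_of_ne (by positivity) ?_
  rw [equation_iff_paper]
  simp

lemma nonsingular_start : M.ellipticCurve.Nonsingular (-1)
    (M.kappa * (-((1 - M.α ^ 2) / (1 + M.α ^ 2)))) := by
  have ha := M.a_pos
  have hα := M.α_pos
  have hk := M.kappa_pos
  have h1 : 0 < 1 - M.α ^ 2 := by nlinarith [M.α_lt_one]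
  have h2 : 0 < (1 - M.α ^ 2) / (1 + M.α ^ 2) := by positivity
  refine M.nonsingular_of_ne (mul_ne_zero hk.ne' (neg_ne_zero.mpr h2.ne')) ?_
  rw [equation_iff_paper]
  field_simp
  ring

/-- The point `(a⁻², a⁻²)` of the elliptic curve. -/
def shiftPoint : M.ellipticCurve.Point := .some _ _ M.nonsingular_shift

/-- The initial point `(x₀, y₀) = (-1, -(1-α²)/(1+α²))` of the flow. -/
def startPoint : M.ellipticCurve.Point := .some _ _ M.nonsingular_start

/-- The translation `σ(x,y) = (x,y) + (a⁻², a⁻²)`. -/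
def sigma (S : M.ellipticCurve.Point) : M.ellipticCurve.Point := S + M.shiftPoint

/-- The coordinates `(x, y)` of a point (the flow never reaches the point at infinity). -/
def coords : M.ellipticCurve.Point → ℝ × ℝ
  | .zero => (0, 0)
  | .some X Y _ => (X, Y / M.kappa)

/-- `(x_k, y_k) = σ^k(x₀, y₀)`. -/
def flow (k : ℕ) : ℝ × ℝ := M.coords (M.sigma^[k] M.startPoint)

/-- The function `a(x,y)`. -/
def aFun (s : ℝ × ℝ) : ℝ :=
  M.a * (M.a ^ 2 + 1) * (M.α ^ 2 + 1) / 2 * ((s.2 - s.1) / (1 - M.a ^ 2 * s.1))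

/-- The function `b(x,y)`. -/
def bFun (s : ℝ × ℝ) : ℝ := -(1 / (M.α * M.a * s.1))

/-- The function `d(x,y)`. -/
def dFun (s : ℝ × ℝ) : ℝ :=
  2 * M.a * M.α * s.1 * (s.1 - 1 / M.a ^ 2) /
    ((M.a ^ 2 + 1) * (M.α + 1 / M.α) * (s.2 - s.1))

/-- The matrix `𝒫₋(x,y)`, as a function of `z`. -/
def calPminus (s : ℝ × ℝ) (z : ℂ) : Matrix (Fin 2) (Fin 2) ℂ :=
  (M.bFun s : ℂ) • (!![(M.aFun s : ℂ), 0; 0, 1] * !![1, 1; M.a ^ 2 / z, 1] *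
    !![1, 0; 0, (M.aFun s : ℂ)])

/-- The matrix `𝒫₊(x,y)`, as a function of `z`. -/
def calPplus (s : ℝ × ℝ) (z : ℂ) : Matrix (Fin 2) (Fin 2) ℂ :=
  !![1, 0; 0, (M.a ^ 2 / M.α ^ 2 * M.dFun s : ℂ)] * !![1, M.a ^ 2 * z; 1, 1] *
    !![1, 0; 0, (M.dFun s : ℂ)]

/-- `P₋^{(d)}(z) = P_{0,-}(z) ⋯ P_{d-1,-}(z)`, where `P_{k,-} = 𝒫₋(σ^k(x₀,y₀))`. -/
def Pminus (d : ℕ) (z : ℂ) : Matrix (Fin 2) (Fin 2) ℂ :=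
  ((List.range d).map fun k => M.calPminus (M.flow k) z).prod

/-- `P₊^{(d)}(z) = P_{d-1,+}(z) ⋯ P_{0,+}(z)`, where `P_{k,+} = 𝒫₊(σ^k(x₀,y₀))`. -/
def Pplus (d : ℕ) (z : ℂ) : Matrix (Fin 2) (Fin 2) ℂ :=
  ((List.range d).reverse.map fun k => M.calPplus (M.flow k) z).prod

/-! ### The discriminant of the spectral curve -/

/-- The trace `(α + 1/α)(1 + a²)` of `P(z)`. -/
def T : ℝ := (M.α + 1 / M.α) * (1 + M.a ^ 2)

/-- The spectral curve `det (P(z) - λ) = 0`, written out. -/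
lemma det_P_sub (z l : ℂ) (hz : z ≠ 0) : (M.P z - l • (1 : Matrix (Fin 2) (Fin 2) ℂ)).det =
    l ^ 2 - M.T * l + (1 - M.a ^ 2 * z) * (1 - M.a ^ 2 / z) := by
  have hα : (M.α : ℂ) ≠ 0 := by exact_mod_cast M.α_pos.ne'
  simp [P, T, Matrix.det_fin_two]
  field_simp
  ring

/-- The discriminant `R(z)` of the spectral curve. -/
def R (z : ℂ) : ℂ :=
  (M.α + 1 / M.α) ^ 2 * (1 + M.a ^ 2) ^ 2 - 4 * (1 - M.a ^ 2 * z) * (1 - M.a ^ 2 / z)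

/-- The coefficient `K` in `z R(z) = 4a²z² + K z + 4a²`. -/
def K : ℝ := (M.α + 1 / M.α) ^ 2 * (1 + M.a ^ 2) ^ 2 - 4 * (1 + M.a ^ 4)

lemma K_gt : 8 * M.a ^ 2 < M.K := by
  have ha := M.a_pos
  have hα := M.α_pos
  have h1 : M.K - 8 * M.a ^ 2 = (1 + M.a ^ 2) ^ 2 * ((1 - M.α ^ 2) / M.α) ^ 2 := by
    unfold K; field_simp; ring
  have h2 : 0 < 1 - M.α ^ 2 := by nlinarith [M.α_lt_one]
  have : 0 < (1 + M.a ^ 2) ^ 2 * ((1 - M.α ^ 2) / M.α) ^ 2 := by positivity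
  linarith

/-- The smaller zero `x₁` of `R`. -/
def x₁ : ℝ := (-M.K - √(M.K ^ 2 - 64 * M.a ^ 4)) / (8 * M.a ^ 2)

/-- The larger zero `x₂` of `R`. -/
def x₂ : ℝ := (-M.K + √(M.K ^ 2 - 64 * M.a ^ 4)) / (8 * M.a ^ 2)

lemma K_sq_gt : 0 < M.K ^ 2 - 64 * M.a ^ 4 := by
  have := M.K_gt
  have ha := M.a_pos
  nlinarith [sq_nonneg M.a, pow_pos ha 2]

lemma x₁_lt_x₂ : M.x₁ < M.x₂ := by
  have ha := M.a_pos
  have := Real.sqrt_pos.mpr M.K_sq_gt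
  unfold x₁ x₂
  gcongr
  linarith

lemma x₂_neg : M.x₂ < 0 := by
  have ha := M.a_pos
  have hK : 0 < M.K := lt_trans (by positivity) M.K_gt
  have : √(M.K ^ 2 - 64 * M.a ^ 4) < M.K := by
    rw [Real.sqrt_lt' hK]
    have := pow_pos ha 4
    linarith
  unfold x₂
  apply div_neg_of_neg_of_pos _ (by positivity)
  linarith

lemma R_eq (z : ℂ) (hz : z ≠ 0) : M.R z = 4 * M.a ^ 2 * (z - M.x₁) * (z - M.x₂) / z := by
  have ha : (M.a : ℂ) ≠ 0 := by exact_mod_cast M.a_pos.ne'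
  have hs : ((√(M.K ^ 2 - 64 * M.a ^ 4) : ℝ) : ℂ) ^ 2 = (M.K : ℂ) ^ 2 - 64 * M.a ^ 4 := by
    have := Real.sq_sqrt M.K_sq_gt.le
    exact_mod_cast this
  have hK : (M.K : ℂ) = (M.α + 1 / M.α) ^ 2 * (1 + M.a ^ 2) ^ 2 - 4 * (1 + M.a ^ 4) := by
    simp [K]
  have hR : M.R z = (4 * M.a ^ 2 * z ^ 2 + M.K * z + 4 * M.a ^ 2) / z := by
    rw [hK]; unfold R; field_simp; ring
  rw [hR]
  congr 1
  simp only [x₁, x₂]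
  push_cast
  field_simp
  linear_combination (4 : ℂ) * hs

/-! ### The Riemann surface `ℛ`

The affine part of the curve is described by the coordinates `z` and `v = z R(z)^{1/2}`, which
satisfy `v² = z² R(z)`, a cubic polynomial in `z`.  This includes the point over `z = 0`, which is
`(0,0)`; one point is added over `z = ∞`. -/

/-- The cubic polynomial `z² R(z)`. -/
def cubic (z : ℂ) : ℂ :=
  z * ((M.α + 1 / M.α) ^ 2 * (1 + M.a ^ 2) ^ 2 * z - 4 * (1 - M.a ^ 2 * z) * (z - M.a ^ 2))

lemma cubic_eq_sq_mul_R (z : ℂ) (hz : z ≠ 0) : M.cubic z = z ^ 2 * M.R z := by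
  unfold cubic R; field_simp

lemma cubic_eq (z : ℂ) : M.cubic z = 4 * M.a ^ 2 * z ^ 3 + M.K * z ^ 2 + 4 * M.a ^ 2 * z := by
  have hK : (M.K : ℂ) = (M.α + 1 / M.α) ^ 2 * (1 + M.a ^ 2) ^ 2 - 4 * (1 + M.a ^ 4) := by
    simp [K]
  rw [hK, cubic]; ring

/-- The affine part of `ℛ`: all `(z, v)` with `v² = z² R(z)`. -/
abbrev Curve : Type := {p : ℂ × ℂ // p.2 ^ 2 = M.cubic p.1}

/-- The compact Riemann surface `ℛ`; the added point lies over `z = ∞`. -/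
abbrev Surface : Type := OnePoint M.Curve

/-- The difference quotient of the cubic at `e`. -/
def quot (e z : ℂ) : ℂ :=
  4 * M.a ^ 2 * (z ^ 2 + z * e + e ^ 2) + M.K * (z + e) + 4 * M.a ^ 2

lemma cubic_sub (e z : ℂ) : M.cubic z - M.cubic e = (z - e) * M.quot e z := by
  rw [cubic_eq, cubic_eq, quot]; ring

lemma quot_self_ne_zero {e : ℂ} (he : M.cubic e = 0) : M.quot e e ≠ 0 := by
  have ha : (M.a : ℂ) ≠ 0 := by exact_mod_cast M.a_pos.ne'
  intro h
  rw [cubic_eq] at he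
  unfold quot at h
  have h0 : e ≠ 0 := by
    rintro rfl
    simp [ha] at h
  have h1 : 4 * (M.a : ℂ) ^ 2 * e ^ 2 + M.K * e + 4 * M.a ^ 2 = 0 := by
    apply mul_left_cancel₀ h0
    linear_combination he
  have h2 : 8 * (M.a : ℂ) ^ 2 * e + M.K = 0 := by
    apply mul_left_cancel₀ h0
    linear_combination h - h1
  have h3 : (M.K : ℂ) ^ 2 - 64 * M.a ^ 4 = 0 := by
    linear_combination (-16 * (M.a : ℂ) ^ 2) * h1 + (8 * (M.a : ℂ) ^ 2 * e + M.K) * h2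
  have h4 : M.K ^ 2 - 64 * M.a ^ 4 = 0 := by exact_mod_cast h3
  exact M.K_sq_gt.ne' h4

/-- The principal square root. -/
def csqrt (w : ℂ) : ℂ := w ^ (1 / 2 : ℂ)

lemma csqrt_sq (w : ℂ) : csqrt w ^ 2 = w := by
  unfold csqrt
  rw [← Complex.cpow_nat_mul]
  simp

lemma csqrt_ne_zero {w : ℂ} (hw : w ≠ 0) : csqrt w ≠ 0 := by
  intro h
  apply hw
  rw [← csqrt_sq w, h]
  simp

lemma csqrt_one : csqrt 1 = 1 := by simp [csqrt]

lemma csqrt_re_pos {w : ℂ} (hw : w ∈ slitPlane) : 0 < (csqrt w).re := by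
  have hw0 := slitPlane_ne_zero hw
  unfold csqrt
  rw [cpow_def_of_ne_zero hw0, exp_re]
  apply mul_pos (Real.exp_pos _)
  have h1 := neg_pi_lt_arg w
  have h2 := lt_of_le_of_ne (arg_le_pi w) ((mem_slitPlane_iff_arg.mp hw).1)
  have him : (Complex.log w * (1 / 2)).im = arg w / 2 := by
    have : Complex.log w * (1 / 2) = Complex.log w / (2 : ℝ) := by push_cast; ring
    rw [this, div_ofReal_im, log_im]
  rw [him]
  apply Real.cos_pos_of_mem_Ioo
  constructor <;> linarith

lemma csqrt_eq {w u : ℂ} (hu : 0 < u.re) (h : u ^ 2 = w) : w ∈ slitPlane ∧ csqrt w = u := by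
  have hw : w ∈ slitPlane := by
    rw [mem_slitPlane_iff, ← h]
    by_cases him : u.im = 0
    · left
      simp [pow_two, him, hu]
    · right
      simp only [pow_two, mul_im]
      intro h0
      have : u.re * u.im = 0 := by linarith
      rcases mul_eq_zero.mp this with h1 | h1
      · exact hu.ne' h1
      · exact him h1
  refine ⟨hw, ?_⟩
  have h2 : (csqrt w - u) * (csqrt w + u) = 0 := by
    linear_combination csqrt_sq w - h
  rcases mul_eq_zero.mp h2 with h3 | h3
  · exact sub_eq_zero.mp h3
  · exfalso
    have := csqrt_re_pos hw
    have h4 := congrArg Complex.re h3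
    simp at h4
    linarith

lemma csqrt_analyticAt {w : ℂ} (hw : w ∈ slitPlane) : AnalyticAt ℂ csqrt w := by
  unfold csqrt
  exact analyticAt_id.cpow analyticAt_const hw

lemma analyticAt_cubic (z : ℂ) : AnalyticAt ℂ M.cubic z := by
  unfold cubic; fun_prop

lemma analyticAt_quot (e z : ℂ) : AnalyticAt ℂ (M.quot e) z := by
  unfold quot; fun_prop

lemma continuous_cubic : Continuous M.cubic :=
  continuous_iff_continuousAt.mpr fun z => (M.analyticAt_cubic z).continuousAt

lemma continuous_quot (e : ℂ) : Continuous (M.quot e) :=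
  continuous_iff_continuousAt.mpr fun z => (M.analyticAt_quot e z).continuousAt

lemma ordinary_mem (p₀ : M.Curve) (h₀ : p₀.1.2 ≠ 0) (t : ℂ) :
    (p₀.1.2 * csqrt (M.cubic t / M.cubic p₀.1.1)) ^ 2 = M.cubic t := by
  have : M.cubic p₀.1.1 ≠ 0 := by rw [← p₀.2]; exact pow_ne_zero 2 h₀
  rw [mul_pow, csqrt_sq, p₀.2]
  field_simp

/-- The local coordinate `z` near a point `(z₀, v₀)` with `v₀ ≠ 0`. -/
def ordinaryChart (p₀ : M.Curve) (h₀ : p₀.1.2 ≠ 0) : OpenPartialHomeomorph M.Curve ℂ where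
  toFun p := p.1.1
  invFun t := ⟨(t, p₀.1.2 * csqrt (M.cubic t / M.cubic p₀.1.1)),
    M.ordinary_mem p₀ h₀ t⟩
  source := {p | 0 < (p.1.2 / p₀.1.2).re}
  target := {t | M.cubic t / M.cubic p₀.1.1 ∈ slitPlane}
  map_source' := by
    intro p hp
    exact (csqrt_eq hp (by rw [div_pow, p.2, p₀.2])).1
  map_target' := by
    intro t ht
    simp only [Set.mem_ofPred_eq, mul_div_cancel_left₀ _ h₀]
    exact csqrt_re_pos ht
  left_inv' := by
    intro p hp
    have := (csqrt_eq hp (by rw [div_pow, p.2, p₀.2])).2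
    apply Subtype.ext
    refine Prod.ext rfl ?_
    simp only [this]
    field_simp
  right_inv' := by
    intro t _
    rfl
  open_source := by
    apply isOpen_lt continuous_const
    fun_prop
  open_target := by
    have := M.continuous_cubic
    exact isOpen_slitPlane.preimage (by fun_prop)
  continuousOn_toFun := by fun_prop
  continuousOn_invFun := by
    refine Topology.IsInducing.subtypeVal.continuousOn_iff.mpr ?_
    intro t ht
    apply ContinuousAt.continuousWithinAt
    have h1 : ContinuousAt csqrt (M.cubic t / M.cubic p₀.1.1) :=
      (csqrt_analyticAt ht).continuousAt
    have h2 : ContinuousAt (fun t => M.cubic t / M.cubic p₀.1.1) t :=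
      (M.continuous_cubic.div_const _).continuousAt
    exact continuousAt_id.prodMk
      (continuousAt_const.mul (ContinuousAt.comp (g := csqrt) h1 h2))

lemma branch_mem (e : ℂ) (he : M.cubic e = 0) (t : ℂ) :
    (t * csqrt (M.quot e (e + t ^ 2 / M.quot e e) / M.quot e e)) ^ 2 =
      M.cubic (e + t ^ 2 / M.quot e e) := by
  have h1 := M.quot_self_ne_zero he
  have h2 := M.cubic_sub e (e + t ^ 2 / M.quot e e)
  rw [he, sub_zero] at h2
  rw [mul_pow, csqrt_sq, h2]
  field_simp
  ring

/-- The local coordinate near a branch point `(e, 0)`: it is `t = v / √(g(z)/g(e))`, where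
`g(z) = z² R(z) / (z - e)`, so that `z = e + t² / g(e)`. -/
def branchChart (e : ℂ) (he : M.cubic e = 0) : OpenPartialHomeomorph M.Curve ℂ where
  toFun p := p.1.2 / csqrt (M.quot e p.1.1 / M.quot e e)
  invFun t := ⟨(e + t ^ 2 / M.quot e e,
      t * csqrt (M.quot e (e + t ^ 2 / M.quot e e) / M.quot e e)),
    M.branch_mem e he t⟩
  source := {p | M.quot e p.1.1 / M.quot e e ∈ slitPlane}
  target := {t | M.quot e (e + t ^ 2 / M.quot e e) / M.quot e e ∈ slitPlane}
  map_source' := by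
    intro p hp
    have h1 := M.quot_self_ne_zero he
    have hq : M.quot e p.1.1 ≠ 0 := fun h => slitPlane_ne_zero hp (by simp [h])
    have h2 := M.cubic_sub e p.1.1
    rw [he, sub_zero, ← p.2] at h2
    have h3 : e + (p.1.2 / csqrt (M.quot e p.1.1 / M.quot e e)) ^ 2 / M.quot e e = p.1.1 := by
      rw [div_pow, csqrt_sq, h2]
      field_simp
      ring
    simp only [Set.mem_ofPred_eq, h3]
    exact hp
  map_target' := by
    intro t ht
    exact ht
  left_inv' := by
    intro p hp
    have h1 := M.quot_self_ne_zero he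
    have hq : M.quot e p.1.1 ≠ 0 := fun h => slitPlane_ne_zero hp (by simp [h])
    have h2 := M.cubic_sub e p.1.1
    rw [he, sub_zero, ← p.2] at h2
    have h3 : e + (p.1.2 / csqrt (M.quot e p.1.1 / M.quot e e)) ^ 2 / M.quot e e = p.1.1 := by
      rw [div_pow, csqrt_sq, h2]
      field_simp
      ring
    have h4 := csqrt_ne_zero (slitPlane_ne_zero hp)
    apply Subtype.ext
    simp only [h3]
    refine Prod.ext rfl ?_
    simp only
    field_simp
  right_inv' := by
    intro t ht
    have h4 := csqrt_ne_zero (slitPlane_ne_zero ht)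
    simp only
    field_simp
  open_source := by
    have := M.continuous_quot e
    exact isOpen_slitPlane.preimage (by fun_prop)
  open_target := by
    have := M.continuous_quot e
    exact isOpen_slitPlane.preimage (by fun_prop)
  continuousOn_toFun := by
    intro p hp
    apply ContinuousAt.continuousWithinAt
    have h1 : ContinuousAt csqrt (M.quot e p.1.1 / M.quot e e) :=
      (csqrt_analyticAt hp).continuousAt
    have h0 := M.continuous_quot e
    have h2 : ContinuousAt (fun p : M.Curve => M.quot e p.1.1 / M.quot e e) p :=
      Continuous.continuousAt (by fun_prop)
    have h3 : ContinuousAt (fun p : M.Curve => p.1.2) p := Continuous.continuousAt (by fun_prop)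
    exact h3.div (ContinuousAt.comp (g := csqrt) h1 h2) (csqrt_ne_zero (slitPlane_ne_zero hp))
  continuousOn_invFun := by
    refine Topology.IsInducing.subtypeVal.continuousOn_iff.mpr ?_
    intro t ht
    apply ContinuousAt.continuousWithinAt
    have h1 : ContinuousAt csqrt (M.quot e (e + t ^ 2 / M.quot e e) / M.quot e e) :=
      (csqrt_analyticAt ht).continuousAt
    have h0 := M.continuous_quot e
    have h2 : ContinuousAt (fun t => M.quot e (e + t ^ 2 / M.quot e e) / M.quot e e) t :=
      Continuous.continuousAt (by fun_prop)
    have h3 : ContinuousAt (fun t => e + t ^ 2 / M.quot e e) t :=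
      Continuous.continuousAt (by fun_prop)
    exact h3.prodMk (continuousAt_id.mul (ContinuousAt.comp (g := csqrt) h1 h2))

/-- The polynomial `s R(1/s) = 4a² + K s + 4a² s²`. -/
def recip (s : ℂ) : ℂ := 4 * M.a ^ 2 + M.K * s + 4 * M.a ^ 2 * s ^ 2

lemma analyticAt_recip (s : ℂ) : AnalyticAt ℂ M.recip s := by
  unfold recip; fun_prop

lemma continuous_recip : Continuous M.recip :=
  continuous_iff_continuousAt.mpr fun z => (M.analyticAt_recip z).continuousAt

lemma cubic_eq_recip (z : ℂ) (hz : z ≠ 0) : M.cubic z = z ^ 3 * M.recip (1 / z) := by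
  rw [cubic_eq, recip]; field_simp

/-- The coordinate near the point at infinity: it is `t = z √(R(z)/z) / v`, so that
`z = 1/t²`. -/
def inftyCoord : M.Surface → ℂ :=
  fun x => x.elim 0 fun p => p.1.1 * csqrt (M.recip (1 / p.1.1)) / p.1.2

@[simp] lemma inftyCoord_infty : M.inftyCoord ∞ = 0 := rfl

@[simp] lemma inftyCoord_coe (p : M.Curve) :
    M.inftyCoord p = p.1.1 * csqrt (M.recip (1 / p.1.1)) / p.1.2 := rfl

lemma infty_mem (t : ℂ) :
    (csqrt (M.recip (t ^ 2)) / t ^ 3) ^ 2 = M.cubic (1 / t ^ 2) := by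
  by_cases ht : t = 0
  · simp [ht, cubic]
  rw [cubic_eq_recip _ _ (by simp [ht]), div_pow, csqrt_sq]
  simp only [one_div, inv_inv]
  field_simp

/-- The finite points near infinity (for `t ≠ 0`): `z = 1/t²`, `v = √(t² R(1/t²)) / t³`. -/
def nearInfty (t : ℂ) : M.Curve :=
  ⟨(1 / t ^ 2, csqrt (M.recip (t ^ 2)) / t ^ 3), M.infty_mem t⟩

open Classical in
/-- The parametrization near infinity. -/
def inftyParam (t : ℂ) : M.Surface := if t = 0 then ∞ else (M.nearInfty t : M.Surface)

lemma inftyCoord_sq {p : M.Curve} (hz : p.1.1 ≠ 0) (hr : M.recip (1 / p.1.1) ≠ 0) :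
    (M.inftyCoord p) ^ 2 = 1 / p.1.1 := by
  rw [inftyCoord_coe, div_pow, mul_pow, csqrt_sq, p.2, cubic_eq_recip _ _ hz]
  field_simp

lemma isClosed_curve : IsClosed {p : ℂ × ℂ | p.2 ^ 2 = M.cubic p.1} := by
  have := M.continuous_cubic
  exact isClosed_eq (by fun_prop) (by fun_prop)

instance : LocallyCompactSpace M.Curve := M.isClosed_curve.locallyCompactSpace

lemma isCompact_le (r : ℝ) : IsCompact {p : M.Curve | ‖p.1.1‖ ≤ r} := by
  obtain ⟨C, hC⟩ := (isCompact_closedBall (0 : ℂ) r).exists_bound_of_continuousOn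
    M.continuous_cubic.continuousOn
  have hemb : Topology.IsClosedEmbedding (Subtype.val : M.Curve → ℂ × ℂ) :=
    M.isClosed_curve.isClosedEmbedding_subtypeVal
  have hcomp : IsCompact (Metric.closedBall (0 : ℂ) r ×ˢ Metric.closedBall (0 : ℂ) (C + 1)) :=
    (isCompact_closedBall _ _).prod (isCompact_closedBall _ _)
  refine (hemb.isCompact_preimage hcomp).of_isClosed_subset ?_ ?_
  · exact isClosed_le (by fun_prop) continuous_const
  · intro p hp
    have h1 : p.1.1 ∈ Metric.closedBall (0 : ℂ) r := by simpa using hp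
    refine ⟨h1, ?_⟩
    have h2 := hC _ h1
    rw [← p.2, norm_pow] at h2
    simp only [mem_closedBall_zero_iff]
    nlinarith [sq_nonneg (‖p.1.2‖ - 1), norm_nonneg p.1.2]

lemma continuousAt_inftyCoord : ContinuousAt M.inftyCoord ∞ := by
  rw [OnePoint.continuousAt_infty', coclosedCompact_eq_cocompact, inftyCoord_infty]
  rw [Metric.tendsto_nhds]
  intro ε hε
  rw [Filter.eventually_iff, mem_cocompact]
  refine ⟨_, M.isCompact_le (1 / ε ^ 2), ?_⟩
  intro p hp
  have hp' : 1 / ε ^ 2 < ‖p.1.1‖ := by simpa using hp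
  have hz : p.1.1 ≠ 0 := by
    intro h
    rw [h, norm_zero] at hp'
    have : 0 < 1 / ε ^ 2 := by positivity
    linarith
  simp only [Function.comp_apply, Set.mem_ofPred_eq, dist_zero_right]
  by_cases hr : M.recip (1 / p.1.1) = 0
  · have : csqrt 0 = 0 := by simp [csqrt]
    simp [hr, this, hε, -one_div]
  · have h1 := congrArg norm (M.inftyCoord_sq hz hr)
    rw [norm_pow, norm_div, norm_one] at h1
    apply lt_of_pow_lt_pow_left₀ 2 hε.le
    rw [h1, div_lt_comm₀ (norm_pos_iff.mpr hz) (by positivity)]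
    exact hp'

lemma inftyParam_zero : M.inftyParam 0 = ∞ := by simp [inftyParam]

lemma inftyParam_of_ne {t : ℂ} (ht : t ≠ 0) : M.inftyParam t =
    (M.nearInfty t : M.Surface) := by
  simp [inftyParam, ht]

lemma continuousAt_inftyParam_zero : ContinuousAt M.inftyParam 0 := by
  rw [ContinuousAt, inftyParam_zero, Tendsto, OnePoint.le_nhds_infty]
  intro s _ hs
  obtain ⟨C, hC⟩ := hs.exists_bound_of_continuousOn
    (f := fun p : M.Curve => p.1.1) (by fun_prop)
  have h1 : ∀ᶠ t : ℂ in 𝓝 0, ‖t‖ ^ 2 * (|C| + 1) < 1 := by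
    have : ContinuousAt (fun t : ℂ => ‖t‖ ^ 2 * (|C| + 1)) 0 :=
      Continuous.continuousAt (by fun_prop)
    exact this.eventually (gt_mem_nhds (by simp))
  rw [mem_map]
  filter_upwards [h1] with t ht
  by_cases h0 : t = 0
  · right; simp [h0, inftyParam_zero]
  · left
    rw [inftyParam_of_ne _ h0]
    refine ⟨_, ?_, rfl⟩
    intro hmem
    have h2 := hC _ hmem
    have h3 : 0 < ‖t‖ ^ 2 := by positivity
    simp only [nearInfty, norm_div, norm_one, norm_pow] at h2
    rw [div_le_iff₀ h3] at h2
    nlinarith [le_abs_self C]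

lemma recip_zero_mem : M.recip 0 ∈ slitPlane := by
  have h : M.recip 0 = ((4 * M.a ^ 2 : ℝ) : ℂ) := by simp [recip]
  rw [h, ofReal_mem_slitPlane]
  have := M.a_pos
  positivity

lemma continuousAt_inftyParam {t : ℂ} (h0 : t ≠ 0) (ht : M.recip (t ^ 2) ∈ slitPlane) :
    ContinuousAt M.inftyParam t := by
  have h1 : ContinuousAt (fun t => M.recip (t ^ 2)) t :=
    (M.continuous_recip.comp (continuous_pow 2)).continuousAt
  have h2 : ContinuousAt (fun t => csqrt (M.recip (t ^ 2))) t :=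
    ContinuousAt.comp (g := csqrt) (csqrt_analyticAt ht).continuousAt h1
  have h3 : ContinuousAt M.nearInfty t := by
    refine Topology.IsInducing.subtypeVal.continuousAt_iff.mpr ?_
    exact (continuousAt_const.div (continuousAt_id.pow 2) (pow_ne_zero 2 h0)).prodMk
      (h2.div (continuousAt_id.pow 3) (pow_ne_zero 3 h0))
  have h4 : ContinuousAt (fun t => (M.nearInfty t : M.Surface)) t :=
    OnePoint.continuous_coe.continuousAt.comp h3
  refine h4.congr ?_
  filter_upwards [isOpen_ne.mem_nhds h0] with s hs
  exact (M.inftyParam_of_ne hs).symm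

/-- A neighbourhood of the point at infinity. -/
def inftySource : Set M.Surface :=
  {∞} ∪ (↑) '' {p : M.Curve | p.1.1 ≠ 0 ∧ M.recip (1 / p.1.1) ∈ slitPlane}

lemma isOpen_inftySource : IsOpen M.inftySource := by
  have hpre : ((↑) : M.Curve → M.Surface) ⁻¹' M.inftySource =
      {p : M.Curve | p.1.1 ≠ 0 ∧ M.recip (1 / p.1.1) ∈ slitPlane} := by
    ext p
    simp [inftySource]
  have hopen : IsOpen {p : M.Curve | p.1.1 ≠ 0 ∧ M.recip (1 / p.1.1) ∈ slitPlane} := by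
    rw [isOpen_iff_mem_nhds]
    rintro p ⟨hz, hp⟩
    have h4 : ContinuousAt (fun p : M.Curve => p.1.1) p := Continuous.continuousAt (by fun_prop)
    have h6 : ContinuousAt (fun p : M.Curve => M.recip (1 / p.1.1)) p :=
      M.continuous_recip.continuousAt.comp (continuousAt_const.div h4 hz)
    filter_upwards [h4.eventually (isOpen_ne.mem_nhds hz),
      h6.eventually (isOpen_slitPlane.mem_nhds hp)] with q h1 h2
    exact ⟨h1, h2⟩
  rw [OnePoint.isOpen_iff_of_mem (by simp [inftySource]), hpre]
  refine ⟨hopen.isClosed_compl, ?_⟩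
  obtain ⟨δ, hδ, hball⟩ := Metric.mem_nhds_iff.mp
    (M.continuous_recip.continuousAt.eventually (isOpen_slitPlane.mem_nhds M.recip_zero_mem))
  refine (M.isCompact_le (1 / δ)).of_isClosed_subset hopen.isClosed_compl ?_
  intro p hp
  by_contra hlt
  have hlt' : 1 / δ < ‖p.1.1‖ := by simpa using hlt
  have hpos : 0 < ‖p.1.1‖ := lt_trans (by positivity) hlt'
  apply hp
  refine ⟨norm_pos_iff.mp hpos, ?_⟩
  have hmem : (1 / p.1.1) ∈ Metric.ball (0 : ℂ) δ := by
    rw [mem_ball_zero_iff, norm_div, norm_one, div_lt_comm₀ hpos hδ]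
    exact hlt'
  exact hball hmem

/-- The local coordinate at infinity. -/
def inftyChart : OpenPartialHomeomorph M.Surface ℂ where
  toFun := M.inftyCoord
  invFun := M.inftyParam
  source := M.inftySource
  target := {t | M.recip (t ^ 2) ∈ slitPlane}
  map_source' := by
    rintro x (rfl | ⟨p, ⟨hz, hp⟩, rfl⟩)
    · have := M.recip_zero_mem
      simpa using this
    · simp only [Set.mem_ofPred_eq]
      rw [M.inftyCoord_sq hz (slitPlane_ne_zero hp)]
      exact hp
  map_target' := by
    intro t ht
    by_cases h0 : t = 0
    · left; simp [h0, inftyParam_zero]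
    · right
      rw [inftyParam_of_ne _ h0]
      refine ⟨_, ⟨?_, ?_⟩, rfl⟩
      · simp [nearInfty, h0]
      · simpa [nearInfty] using ht
  left_inv' := by
    rintro x (rfl | ⟨p, ⟨hz, hp⟩, rfl⟩)
    · simp [inftyParam_zero]
    · have hr := slitPlane_ne_zero hp
      have h1 := M.inftyCoord_sq hz hr
      have h0 : M.inftyCoord p ≠ 0 := by
        intro h
        rw [h] at h1
        simp at h1
        exact hz h1.symm
      have hs := csqrt_ne_zero hr
      have h2 : p.1.2 ≠ 0 := by
        intro h
        apply h0
        simp [h]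
      rw [inftyParam_of_ne _ h0]
      congr 1
      apply Subtype.ext
      refine Prod.ext ?_ ?_
      · simp only [nearInfty, h1]
        simp
      · have h3 : M.inftyCoord p ^ 3 = 1 / p.1.1 * M.inftyCoord p := by rw [← h1]; ring
        simp only [nearInfty, h3, h1]
        rw [inftyCoord_coe]
        field_simp
  right_inv' := by
    intro t ht
    by_cases h0 : t = 0
    · simp [h0, inftyParam_zero]
    · have hs := csqrt_ne_zero (slitPlane_ne_zero ht)
      rw [inftyParam_of_ne _ h0, inftyCoord_coe]
      simp only [nearInfty, one_div, inv_inv]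
      field_simp
  open_source := M.isOpen_inftySource
  open_target := by
    have := M.continuous_recip
    exact isOpen_slitPlane.preimage (by fun_prop)
  continuousOn_toFun := by
    rintro x (rfl | ⟨p, ⟨hz, hp⟩, rfl⟩)
    · exact M.continuousAt_inftyCoord.continuousWithinAt
    · apply ContinuousAt.continuousWithinAt
      rw [OnePoint.continuousAt_coe]
      have hr := slitPlane_ne_zero hp
      have h2 : p.1.2 ≠ 0 := by
        intro h
        have h3 := p.2
        rw [h, cubic_eq_recip _ _ hz] at h3
        have h4 : p.1.1 ^ 3 * M.recip (1 / p.1.1) = 0 := by rw [← h3]; ring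
        exact mul_ne_zero (pow_ne_zero 3 hz) hr h4
      have h1 : ContinuousAt csqrt (M.recip (1 / p.1.1)) := (csqrt_analyticAt hp).continuousAt
      have h4 : ContinuousAt (fun p : M.Curve => p.1.1) p := Continuous.continuousAt (by fun_prop)
      have h5 : ContinuousAt (fun p : M.Curve => p.1.2) p := Continuous.continuousAt (by fun_prop)
      have h6 : ContinuousAt (fun p : M.Curve => M.recip (1 / p.1.1)) p :=
        M.continuous_recip.continuousAt.comp (continuousAt_const.div h4 hz)
      have h7 : ContinuousAt (fun p : M.Curve => csqrt (M.recip (1 / p.1.1))) p :=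
        ContinuousAt.comp (g := csqrt) h1 h6
      exact (h4.mul h7).div h5 h2
  continuousOn_invFun := by
    intro t ht
    apply ContinuousAt.continuousWithinAt
    by_cases h0 : t = 0
    · rw [h0]; exact M.continuousAt_inftyParam_zero
    · exact M.continuousAt_inftyParam h0 ht

open Classical in
/-- The preferred local coordinate at a finite point. -/
def curveChart (p : M.Curve) : OpenPartialHomeomorph M.Curve ℂ :=
  if h : p.1.2 = 0 then M.branchChart p.1.1 (by rw [← p.2, h]; simp) else M.ordinaryChart p h

/-- The preferred local coordinate at a point of `ℛ`. -/
def chart (x : M.Surface) : OpenPartialHomeomorph M.Surface ℂ :=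
  x.elim M.inftyChart fun p => (M.curveChart p).lift_openEmbedding OnePoint.isOpenEmbedding_coe

@[simp] lemma chart_infty : M.chart ∞ = M.inftyChart := rfl

@[simp] lemma chart_coe (p : M.Curve) : M.chart p =
    (M.curveChart p).lift_openEmbedding OnePoint.isOpenEmbedding_coe := rfl

lemma mem_curveChart_source (p : M.Curve) : p ∈ (M.curveChart p).source := by
  unfold curveChart
  split_ifs with h
  · have h1 : M.cubic p.1.1 = 0 := by rw [← p.2, h]; simp
    change M.quot p.1.1 p.1.1 / M.quot p.1.1 p.1.1 ∈ slitPlane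
    rw [div_self (M.quot_self_ne_zero h1)]
    exact one_mem_slitPlane
  · change 0 < (p.1.2 / p.1.2).re
    rw [div_self h]
    simp

/-- The complex structure of `ℛ`. -/
instance : ChartedSpace ℂ M.Surface where
  atlas := Set.range M.chart
  chartAt := M.chart
  mem_chart_source x := by
    induction x using OnePoint.rec with
    | infty => exact Or.inl rfl
    | coe p => exact ⟨p, M.mem_curveChart_source p, rfl⟩
  chart_mem_atlas x := ⟨x, rfl⟩

lemma curveChart_analytic (p : M.Curve) : ∃ F : ℂ × ℂ → ℂ, ∀ q : M.Curve,
    M.curveChart p q = F q.1 ∧ (q ∈ (M.curveChart p).source → AnalyticAt ℂ F q.1) := by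
  unfold curveChart
  split_ifs with h
  · have h1 : M.cubic p.1.1 = 0 := by rw [← p.2, h]; simp
    refine ⟨fun w => w.2 / csqrt (M.quot p.1.1 w.1 / M.quot p.1.1 p.1.1), fun q => ⟨rfl, ?_⟩⟩
    intro hq
    have hq' : M.quot p.1.1 q.1.1 / M.quot p.1.1 p.1.1 ∈ slitPlane := hq
    have h2 : AnalyticAt ℂ (fun w : ℂ × ℂ => M.quot p.1.1 w.1 / M.quot p.1.1 p.1.1) q.1 :=
      ((M.analyticAt_quot p.1.1 q.1.1).comp analyticAt_fst).div_const
    exact analyticAt_snd.div (AnalyticAt.comp (g := csqrt) (csqrt_analyticAt hq') h2)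
      (csqrt_ne_zero (slitPlane_ne_zero hq'))
  · exact ⟨Prod.fst, fun q => ⟨rfl, fun _ => analyticAt_fst⟩⟩

lemma curveChart_symm_analytic (p : M.Curve) {t : ℂ} (ht : t ∈ (M.curveChart p).target) :
    AnalyticAt ℂ (fun s => ((M.curveChart p).symm s).1) t := by
  revert ht
  unfold curveChart
  split_ifs with h
  · have h1 : M.cubic p.1.1 = 0 := by rw [← p.2, h]; simp
    intro ht
    set e := p.1.1
    have ht' : M.quot e (e + t ^ 2 / M.quot e e) / M.quot e e ∈ slitPlane := ht
    have h2 : AnalyticAt ℂ (fun t => e + t ^ 2 / M.quot e e) t :=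
      analyticAt_const.add (analyticAt_id.pow 2).div_const
    have h3 : AnalyticAt ℂ (fun t => M.quot e (e + t ^ 2 / M.quot e e) / M.quot e e) t :=
      ((M.analyticAt_quot e _).comp h2).div_const
    exact h2.prod (analyticAt_id.mul (AnalyticAt.comp (g := csqrt) (csqrt_analyticAt ht') h3))
  · intro ht
    have ht' : M.cubic t / M.cubic p.1.1 ∈ slitPlane := ht
    have h3 : AnalyticAt ℂ (fun t => M.cubic t / M.cubic p.1.1) t :=
      (M.analyticAt_cubic t).div_const
    exact analyticAt_id.prod
      (analyticAt_const.mul (AnalyticAt.comp (g := csqrt) (csqrt_analyticAt ht') h3))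

lemma chart_analytic (x : M.Surface) : ∃ F : ℂ × ℂ → ℂ, ∀ q : M.Curve,
    M.chart x q = F q.1 ∧ ((q : M.Surface) ∈ (M.chart x).source → AnalyticAt ℂ F q.1) := by
  induction x using OnePoint.rec with
  | infty =>
    refine ⟨fun w => w.1 * csqrt (M.recip (1 / w.1)) / w.2, fun q => ⟨rfl, ?_⟩⟩
    intro hq
    have hq' : (q : M.Surface) ∈ M.inftySource := hq
    have hq2 : q.1.1 ≠ 0 ∧ M.recip (1 / q.1.1) ∈ slitPlane := by
      simpa [inftySource] using hq'
    obtain ⟨hz, hp⟩ := hq2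
    have hv : q.1.2 ≠ 0 := by
      intro h
      have h3 := q.2
      rw [h, cubic_eq_recip _ _ hz] at h3
      have h4 : q.1.1 ^ 3 * M.recip (1 / q.1.1) = 0 := by rw [← h3]; ring
      exact mul_ne_zero (pow_ne_zero 3 hz) (slitPlane_ne_zero hp) h4
    have h1 : AnalyticAt ℂ (fun w : ℂ × ℂ => M.recip (1 / w.1)) q.1 :=
      AnalyticAt.comp (g := M.recip) (M.analyticAt_recip _)
        (analyticAt_const.div analyticAt_fst hz)
    have h2 : AnalyticAt ℂ (fun w : ℂ × ℂ => csqrt (M.recip (1 / w.1))) q.1 :=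
      AnalyticAt.comp (g := csqrt) (csqrt_analyticAt hp) h1
    exact (analyticAt_fst.mul h2).div analyticAt_snd hv
  | coe p =>
    obtain ⟨F, hF⟩ := M.curveChart_analytic p
    refine ⟨F, fun q => ⟨?_, ?_⟩⟩
    · rw [chart_coe, OpenPartialHomeomorph.lift_openEmbedding_apply]
      exact (hF q).1
    · rintro ⟨q', hq', h⟩
      rw [OnePoint.coe_injective h] at hq'
      exact (hF q).2 hq'

lemma chart_symm_analytic (x : M.Surface) {t : ℂ} (ht : t ∈ (M.chart x).target)
    (hne : (M.chart x).symm t ≠ ∞) : ∃ g : ℂ → M.Curve, AnalyticAt ℂ (fun s => (g s).1) t ∧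
      ∀ᶠ s in 𝓝 t, (M.chart x).symm s = g s := by
  induction x using OnePoint.rec with
  | infty =>
    have h0 : t ≠ 0 := by
      rintro rfl
      exact hne M.inftyParam_zero
    refine ⟨M.nearInfty, ?_, ?_⟩
    · have ht' : M.recip (t ^ 2) ∈ slitPlane := ht
      have h1 : AnalyticAt ℂ (fun t => M.recip (t ^ 2)) t :=
        AnalyticAt.comp (g := M.recip) (M.analyticAt_recip _) (analyticAt_id.pow 2)
      have h2 : AnalyticAt ℂ (fun t => csqrt (M.recip (t ^ 2))) t :=
        AnalyticAt.comp (g := csqrt) (csqrt_analyticAt ht') h1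
      exact (analyticAt_const.div (analyticAt_id.pow 2) (pow_ne_zero 2 h0)).prod
        (h2.div (analyticAt_id.pow 3) (pow_ne_zero 3 h0))
    · filter_upwards [isOpen_ne.mem_nhds h0] with s hs
      exact M.inftyParam_of_ne hs
  | coe p =>
    exact ⟨(M.curveChart p).symm, M.curveChart_symm_analytic p ht, Eventually.of_forall fun _ => rfl⟩

lemma eq_infty_of_mem {x : M.Surface} (h : ∞ ∈ (M.chart x).source) : x = ∞ := by
  induction x using OnePoint.rec with
  | infty => rfl
  | coe p =>
    obtain ⟨q, _, hq⟩ := h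
    exact absurd hq (OnePoint.coe_ne_infty q)

open scoped Manifold ContDiff in
/-- The transition maps are holomorphic: `ℛ` is a Riemann surface. -/
instance : IsManifold 𝓘(ℂ) ω M.Surface := by
  apply isManifold_of_contDiffOn
  rintro _ _ ⟨x, rfl⟩ ⟨y, rfl⟩ t ht
  apply ContDiffAt.contDiffWithinAt
  apply AnalyticAt.contDiffAt
  simp only [modelWithCornersSelf_coe, modelWithCornersSelf_coe_symm, Set.preimage_id,
    Set.range_id, Set.inter_univ, Function.comp_id, Function.id_comp] at ht ⊢
  obtain ⟨ht1, ht2⟩ := ht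
  have ht1' : t ∈ (M.chart x).target := ht1
  have ht2' : (M.chart x).symm t ∈ (M.chart y).source := ht2
  by_cases hinf : (M.chart x).symm t = (∞ : M.Surface)
  · have hx : x = (∞ : M.Surface) := by
      apply M.eq_infty_of_mem
      rw [← hinf]
      exact (M.chart x).map_target ht1'
    have hy : y = (∞ : M.Surface) := M.eq_infty_of_mem (by rwa [← hinf])
    subst hx hy
    refine analyticAt_id.congr ?_
    filter_upwards [(M.chart (∞ : M.Surface)).open_target.mem_nhds ht1'] with s hs
    exact ((M.chart (∞ : M.Surface)).right_inv hs).symm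
  · obtain ⟨g, hg, hge⟩ := M.chart_symm_analytic x ht1' hinf
    obtain ⟨F, hF⟩ := M.chart_analytic y
    have h0 := hge.self_of_nhds
    have h1 : AnalyticAt ℂ F (g t).1 := (hF (g t)).2 (by rwa [← h0])
    refine (AnalyticAt.comp (g := F) (f := fun s => (g s).1) h1 hg).congr ?_
    filter_upwards [hge] with s hs
    change F (g s).1 = M.chart y ((M.chart x).symm s)
    rw [hs, (hF (g s)).1]

/-! ### Sheets, the function `λ`, and the eigenvector matrix -/

/-- `ℂ` without the cuts `(-∞, x₁]` and `[x₂, 0]`. -/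
def slitDomain : Set ℂ := ((↑) '' (Set.Iic M.x₁ ∪ Set.Icc M.x₂ 0) : Set ℂ)ᶜ

lemma R_mem_slitPlane {z : ℂ} (hz : z ∈ M.slitDomain) : M.R z ∈ slitPlane := by
  have ha := M.a_pos
  have hcut : ∀ t : ℝ, z = t → ¬ (t ≤ M.x₁ ∨ (M.x₂ ≤ t ∧ t ≤ 0)) := by
    rintro t rfl h
    exact hz ⟨t, h, rfl⟩
  have h0 : z ≠ 0 := fun h => hcut 0 (by simpa using h) (Or.inr ⟨M.x₂_neg.le, le_rfl⟩)
  by_contra hR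
  rw [mem_slitPlane_iff] at hR
  push Not at hR
  obtain ⟨hre, him⟩ := hR
  obtain ⟨r, hr⟩ : ∃ r : ℝ, M.R z = r := ⟨(M.R z).re, by apply Complex.ext <;> simp [him]⟩
  have hr0 : r ≤ 0 := by rw [hr] at hre; simpa using hre
  have h1 : 4 * (M.a : ℂ) ^ 2 * z ^ 2 + M.K * z + 4 * M.a ^ 2 = r * z := by
    apply mul_left_cancel₀ h0
    have h2 := M.cubic_eq_sq_mul_R z h0
    rw [cubic_eq, hr] at h2
    linear_combination h2
  have hB : 0 < (M.K - r) ^ 2 - 64 * M.a ^ 4 := by nlinarith [M.K_gt, pow_pos ha 2]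
  have hs := Real.sq_sqrt hB.le
  set s := √((M.K - r) ^ 2 - 64 * M.a ^ 4) with hsdef
  have hs' : (s : ℂ) ^ 2 = (M.K - r) ^ 2 - 64 * M.a ^ 4 := by exact_mod_cast hs
  have h3 : (8 * (M.a : ℂ) ^ 2 * z + (M.K - r) - s) * (8 * (M.a : ℂ) ^ 2 * z + (M.K - r) + s)
      = 0 := by
    linear_combination (16 * (M.a : ℂ) ^ 2) * h1 - hs'
  have hac : (M.a : ℂ) ≠ 0 := by exact_mod_cast ha.ne'
  obtain ⟨t, ht⟩ : ∃ t : ℝ, z = t := by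
    rcases mul_eq_zero.mp h3 with h | h
    · refine ⟨(s - (M.K - r)) / (8 * M.a ^ 2), ?_⟩
      push_cast
      field_simp
      linear_combination h
    · refine ⟨(-s - (M.K - r)) / (8 * M.a ^ 2), ?_⟩
      push_cast
      field_simp
      linear_combination h
  have ht0 : t ≠ 0 := fun h => h0 (by simp [ht, h])
  have h4 := M.R_eq z h0
  rw [hr, ht] at h4
  have h5 : r = 4 * M.a ^ 2 * (t - M.x₁) * (t - M.x₂) / t := by exact_mod_cast h4
  have h6 : r * t = 4 * M.a ^ 2 * ((t - M.x₁) * (t - M.x₂)) := by rw [h5]; field_simp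
  have h7 := hcut t ht
  push Not at h7
  have h8 := M.x₁_lt_x₂
  have h9 := M.x₂_neg
  have h10 := pow_pos ha 2
  rcases lt_or_gt_of_ne ht0 with h | h
  · have h11 : t < M.x₂ := by
      by_contra h12
      exact absurd (h7.2 (not_lt.mp h12)) (not_lt.mpr h.le)
    have h13 : 0 < (t - M.x₁) * (M.x₂ - t) := mul_pos (by linarith [h7.1]) (by linarith)
    nlinarith
  · have h13 : 0 < (t - M.x₁) * (t - M.x₂) := mul_pos (by linarith) (by linarith)
    nlinarith

/-- The branch of `R(z)^{1/2}` on the first sheet.  On the slit domain `R` avoids `(-∞, 0]`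
(`R_mem_slitPlane`), so the principal square root is analytic there, and it is positive for `z > 0`. -/
def sqrtR (z : ℂ) : ℂ := csqrt (M.R z)

lemma sheet_mem (z : ℂ) : (z * M.sqrtR z) ^ 2 = M.cubic z := by
  by_cases hz : z = 0
  · simp [hz, cubic]
  · rw [mul_pow, sqrtR, csqrt_sq, cubic_eq_sq_mul_R _ _ hz]

/-- The point `z^{(1)}` on the first sheet. -/
def sheet₁ (z : ℂ) : M.Surface := ((⟨(z, z * M.sqrtR z), M.sheet_mem z⟩ : M.Curve) : M.Surface)

/-- The point `z^{(2)}` on the second sheet. -/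
def sheet₂ (z : ℂ) : M.Surface :=
  ((⟨(z, -(z * M.sqrtR z)), by rw [neg_sq]; exact M.sheet_mem z⟩ : M.Curve) : M.Surface)

/-- The point of `ℛ` over `z = 0`. -/
def origin : M.Surface := ((⟨(0, 0), by simp [cubic]⟩ : M.Curve) : M.Surface)

open Classical in
/-- The function `λ = (α + 1/α)(1 + a²)/2 + R^{1/2}/2` on `ℛ`, where `R^{1/2} = v/z`; its poles are
the points over `0` and `∞`, where it is given the value `0`. -/
def lam : M.Surface → ℂ :=
  fun x => x.elim 0 fun p => if p.1.1 = 0 then 0 else M.T / 2 + p.1.2 / p.1.1 / 2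

/-- The eigenvector matrix `E(z)`. -/
def E (z : ℂ) : Matrix (Fin 2) (Fin 2) ℂ :=
  !![M.a * M.α * (1 + z), M.a * M.α * (1 + z);
    M.lam (M.sheet₁ z) - M.α * (M.a ^ 2 + 1), M.lam (M.sheet₂ z) - M.α * (M.a ^ 2 + 1)]

end

end AztecParams

namespace AztecParams

open Complex Topology Filter OnePoint

noncomputable section

variable (M : AztecParams)

/-! ### The flow on the elliptic curve -/

/-! The theorem is an isospectral argument. The flow refactorizes the symbol: `P` equals
$P_{0,-}P_{0,+}$, and swapping the factors gives $P_{k,+}P_{k,-}=P_{k+1,-}P_{k+1,+}$ (`P_eq`,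
`calPplus_mul_calPminus`). Hence $P\,P_-^{(k)}=P_-^{(k)}\,(P_{k,-}P_{k,+})$, a similar relation
holds for $P_+^{(k)}$, and $P^k=P_-^{(k)}P_+^{(k)}$. If the shift has order $d$, the flow returns to
its start after $d$ steps, so both $P_\pm^{(d)}$ commute with $P$.

The diagonal entries of $P$ are constant and distinct. A matrix $N$ commuting with $P(z)$ is
therefore $x+yP(z)$ with $y=(N_{11}-N_{00})/(P_{11}-P_{00})$ (`eq_of_commute`), even where $P(z)$ is
not diagonalizable. It shares the eigenvectors of $P$, and its eigenvalue $x+y\lambda$ is a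
meromorphic function on the surface, finite wherever $z\ne0,\infty$. Taking $N=P_\mp^{(d)}$ gives
$\mu$ and $\nu$, the relation $\lambda^d=\mu\nu$ and the simultaneous diagonalization.

The divisors come from determinants: the eigenvalues at the two points over $z$ multiply to $\det
N(z)$ (`eigenvalue_mul_neg`), which is a constant times $(1-a^2/z)^d$ or $(1-a^2z)^d$. At the branch
points $0$ and $\infty$ the exchange of sheets is $t\mapsto-t$ in the local coordinate, so both
factors have the same order, half that of the determinant (`meromorphicOrderAt_of_mul_neg`). Over
the zero of the determinant, $\lambda$ equals the trace of $P$, which is nonzero, at the point of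
the first sheet. Since $\lambda^d=\mu\nu$ with finite factors, neither factor vanishes there, and
the whole zero sits on the second sheet. -/

/-- The `Y`-intercept, in the Weierstrass coordinates `(x, κ y)`, of the chord through `(x, y)` and
`(a⁻², a⁻²)`. -/
def intercept (s : ℝ × ℝ) : ℝ := M.kappa * (s.2 - s.1) / (1 - M.a ^ 2 * s.1)

/-- The points of the oval `x < 0` of the elliptic curve. -/
def oval : Set (ℝ × ℝ) := {s | M.ellipticCurve.Equation s.1 (M.kappa * s.2) ∧ s.1 < 0}

lemma one_sub_pos {s : ℝ × ℝ} (hs : s ∈ M.oval) : 0 < 1 - M.a ^ 2 * s.1 := by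
  have := pow_pos M.a_pos 2
  nlinarith [hs.2]

lemma weierstrass {s : ℝ × ℝ} (hs : s ∈ M.oval) : (M.kappa * s.2) ^ 2 =
    s.1 ^ 3 + (M.kappa ^ 2 - M.a ^ 2 - 1 / M.a ^ 2) * s.1 ^ 2 + s.1 := by
  have h := hs.1
  rw [WeierstrassCurve.Affine.equation_iff] at h
  simp only [ellipticCurve] at h
  linarith

/-- A zero intercept would put the point on the line $Y=\kappa X$, which meets the curve only at
$X=0,\ a^2,\ a^{-2}$, never on the oval. -/
lemma intercept_ne_zero {s : ℝ × ℝ} (hs : s ∈ M.oval) : M.intercept s ≠ 0 := by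
  have ha := M.a_pos
  have h1 := M.one_sub_pos hs
  have h2 := M.weierstrass hs
  refine div_ne_zero (mul_ne_zero M.kappa_pos.ne' ?_) h1.ne'
  intro h
  have h3 : s.2 = s.1 := sub_eq_zero.mp h
  rw [h3] at h2
  have h4 : s.1 * (s.1 ^ 2 - (M.a ^ 2 + 1 / M.a ^ 2) * s.1 + 1) = 0 := by linear_combination -h2
  have h5 : 0 < -((M.a ^ 2 + 1 / M.a ^ 2) * s.1) := by
    rw [← mul_neg]
    exact mul_pos (by positivity) (by linarith [hs.2])
  rcases mul_eq_zero.mp h4 with h | h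
  · exact hs.2.ne h
  · nlinarith [sq_nonneg s.1]

/-- Substituting the chord $Y=mX+c$ in the cubic leaves the constant term $-c^2$, so by Vieta
$x\,x'\,a^{-2}=c^2$; this also forces $x'<0$. The sum is the reflection of the third intersection
point, so $(x',-Y')$ lies on the same chord, and computing $c$ from that point gives the last
relation. -/
lemma sigma_some {x Y : ℝ} (h : M.ellipticCurve.Nonsingular x Y) (hx : x < 0) :
    ∃ (x' Y' : ℝ) (h' : M.ellipticCurve.Nonsingular x' Y'),
      M.sigma (.some x Y h) = .some x' Y' h' ∧ x' < 0 ∧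
      x * x' = M.a ^ 2 * M.intercept (x, Y / M.kappa) ^ 2 ∧
      M.kappa * (x' + Y' / M.kappa) = -M.intercept (x, Y / M.kappa) * (1 - M.a ^ 2 * x') := by
  have ha := M.a_pos
  have hk := M.kappa_pos
  have hs : (x, Y / M.kappa) ∈ M.oval := by
    refine ⟨?_, hx⟩
    simp only [mul_div_cancel₀ Y hk.ne']
    exact h.1
  have h1 := M.one_sub_pos hs
  have h2 := M.weierstrass hs
  have h3 := M.intercept_ne_zero hs
  have hne : x ≠ 1 / M.a ^ 2 := (lt_trans hx (by positivity)).ne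
  have h5 : x - 1 / M.a ^ 2 = -(1 - M.a ^ 2 * x) / M.a ^ 2 := by field_simp; ring
  simp only [mul_div_cancel₀ Y hk.ne'] at h1 h2
  have hc : M.intercept (x, Y / M.kappa) = (Y - M.kappa * x) / (1 - M.a ^ 2 * x) := by
    simp only [intercept]; field_simp
  have key : M.sigma (.some x Y h) = _ := WeierstrassCurve.Affine.Point.add_of_X_ne hne
  have hprod : x * M.ellipticCurve.addX x (1 / M.a ^ 2)
      (M.ellipticCurve.slope x (1 / M.a ^ 2) Y (M.kappa * (1 / M.a ^ 2))) =
      M.a ^ 2 * M.intercept (x, Y / M.kappa) ^ 2 := by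
    rw [WeierstrassCurve.Affine.slope_of_X_ne hne, hc, h5]
    simp only [WeierstrassCurve.Affine.addX, ellipticCurve]
    have h1' := h1.ne'
    rw [← sub_eq_zero]
    -- The two sides of the Vieta relation differ by a multiple of the equation of the curve.
    have : x * (((Y - M.kappa * (1 / M.a ^ 2)) / (-(1 - M.a ^ 2 * x) / M.a ^ 2)) ^ 2 +
        0 * ((Y - M.kappa * (1 / M.a ^ 2)) / (-(1 - M.a ^ 2 * x) / M.a ^ 2)) -
        (M.kappa ^ 2 - M.a ^ 2 - 1 / M.a ^ 2) - x - 1 / M.a ^ 2) -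
        M.a ^ 2 * ((Y - M.kappa * x) / (1 - M.a ^ 2 * x)) ^ 2 =
        -M.a ^ 2 / (1 - M.a ^ 2 * x) * (Y ^ 2 - (x ^ 3 +
          (M.kappa ^ 2 - M.a ^ 2 - 1 / M.a ^ 2) * x ^ 2 + x)) := by
      generalize hq : 1 - M.a ^ 2 * x = q at h1'
      field_simp
      rw [← hq]
      ring
    rw [this, h2]
    ring
  refine ⟨_, _, _, key, ?_, hprod, ?_⟩
  · have h6 : 0 < M.a ^ 2 * M.intercept (x, Y / M.kappa) ^ 2 := by positivity
    rw [← hprod] at h6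
    by_contra hcon
    exact absurd h6 (not_lt.mpr (mul_nonpos_of_nonpos_of_nonneg hx.le (not_lt.mp hcon)))
  · rw [WeierstrassCurve.Affine.slope_of_X_ne hne, hc, h5]
    simp only [WeierstrassCurve.Affine.addY, WeierstrassCurve.Affine.negY,
      WeierstrassCurve.Affine.negAddY]
    generalize M.ellipticCurve.addX x (1 / M.a ^ 2) _ = x'
    have h1' := h1.ne'
    simp only [ellipticCurve]
    generalize hq : 1 - M.a ^ 2 * x = q at h1'
    field_simp
    rw [← hq]
    ring

/-- The negative oval is preserved, so the orbit never meets the point at infinity and the default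
value of `coords` there is never used. -/
lemma iterate_sigma (k : ℕ) : ∃ (x Y : ℝ) (h : M.ellipticCurve.Nonsingular x Y),
    M.sigma^[k] M.startPoint = .some x Y h ∧ x < 0 := by
  induction k with
  | zero => exact ⟨_, _, M.nonsingular_start, rfl, by norm_num⟩
  | succ k ih =>
    obtain ⟨x, Y, h, hk, hx⟩ := ih
    obtain ⟨x', Y', h', hs, hx', -, -⟩ := M.sigma_some h hx
    exact ⟨x', Y', h', by rw [Function.iterate_succ_apply', hk, hs], hx'⟩

lemma flow_mem_oval (k : ℕ) : M.flow k ∈ M.oval := by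
  obtain ⟨x, Y, h, hk, hx⟩ := M.iterate_sigma k
  rw [flow, hk]
  refine ⟨?_, hx⟩
  simp only [coords, mul_div_cancel₀ Y M.kappa_pos.ne']
  exact h.1

lemma flow_succ (k : ℕ) :
    (M.flow k).1 * (M.flow (k + 1)).1 = M.a ^ 2 * M.intercept (M.flow k) ^ 2 ∧
    M.kappa * ((M.flow (k + 1)).1 + (M.flow (k + 1)).2) =
      -M.intercept (M.flow k) * (1 - M.a ^ 2 * (M.flow (k + 1)).1) := by
  obtain ⟨x, Y, h, hk, hx⟩ := M.iterate_sigma k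
  obtain ⟨x', Y', h', hs, -, h1, h2⟩ := M.sigma_some h hx
  simp only [flow, Function.iterate_succ_apply', hk, hs, coords]
  exact ⟨h1, h2⟩

lemma flow_zero : M.flow 0 = (-1, -((1 - M.α ^ 2) / (1 + M.α ^ 2))) := by
  simp only [flow, Function.iterate_zero, id, startPoint, coords]
  rw [mul_div_cancel_left₀ _ M.kappa_pos.ne']

/-- This is where torsion enters: $\sigma^k$ is translation by $k$ times the shift point. -/
lemma flow_addOrderOf : M.flow (addOrderOf M.shiftPoint) = M.flow 0 := by
  have h : ∀ k, M.sigma^[k] M.startPoint = M.startPoint + k • M.shiftPoint := by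
    intro k
    induction k with
    | zero => simp
    | succ k ih => rw [Function.iterate_succ_apply', ih, sigma, succ_nsmul, add_assoc]
  simp [flow, h, addOrderOf_nsmul_eq_zero]

/-- The intercepts of consecutive chords. -/
lemma intercept_mul {s s' : ℝ × ℝ} (hs' : s' ∈ M.oval)
    (h : M.kappa * (s'.1 + s'.2) = -M.intercept s * (1 - M.a ^ 2 * s'.1)) :
    M.a ^ 2 * (M.intercept s * M.intercept s') * (1 - M.a ^ 2 * s'.1) =
      s'.1 * (s'.1 - M.a ^ 2) := by
  have ha := M.a_pos.ne'
  have h1 := (M.one_sub_pos hs').ne'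
  have h2 := M.weierstrass hs'
  have h3 : M.intercept s' * (1 - M.a ^ 2 * s'.1) = M.kappa * (s'.2 - s'.1) := by
    rw [intercept, div_mul_cancel₀ _ h1]
  apply mul_right_cancel₀ h1
  have h4 : M.a ^ 2 * (1 / M.a ^ 2) = 1 := by field_simp
  -- Multiplying the two expressions for the intercepts produces $\kappa^2(y'^2-x'^2)$, which the
  -- curve equation factors as $x'(x'-a^2)(x'-a^{-2})$; the last factor cancels against $1-a^2x'$.
  linear_combination (M.a ^ 2 * (M.intercept s' * (1 - M.a ^ 2 * s'.1))) * h +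
    (-M.a ^ 2 * (M.kappa * (s'.1 + s'.2))) * h3 - M.a ^ 2 * h2 + s'.1 ^ 2 * h4

/-! ### The refactorization of the matrix symbol -/

/-- Together with `dFun_eq`, this expresses the matrix entries through $x$ and the intercept alone,
which turns the refactorization into the two intercept relations. -/
lemma aFun_eq {s : ℝ × ℝ} : M.aFun s = M.a ^ 2 * M.α * M.intercept s := by
  have ha := M.a_pos.ne'
  have hα := M.α_pos.ne'
  unfold aFun intercept kappa
  field_simp

lemma dFun_eq {s : ℝ × ℝ} (hs : s ∈ M.oval) :
    M.dFun s = -(M.α * s.1) / (M.a ^ 2 * M.intercept s) := by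
  have ha := M.a_pos.ne'
  have hα := M.α_pos.ne'
  have h1 := (M.one_sub_pos hs).ne'
  have hk := M.kappa_pos.ne'
  have hc := M.intercept_ne_zero hs
  have h2 : s.2 - s.1 ≠ 0 := by
    intro h
    apply hc
    simp [intercept, h]
  have h3 : (M.a ^ 2 + 1) * (M.α + 1 / M.α) = 2 * M.a * M.kappa := by
    unfold kappa; field_simp
  unfold dFun intercept
  rw [h3]
  field_simp
  ring

/-- The relation $xx'=a^2c^2$ eliminates $x$. The off-diagonal entries then agree identically,
because $b\,a\,d=\alpha/a$ at every point; the diagonal ones agree by the product formula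
`intercept_mul`. -/
lemma calPplus_mul_calPminus {s s' : ℝ × ℝ} (hs : s ∈ M.oval) (hs' : s' ∈ M.oval)
    (h1 : s.1 * s'.1 = M.a ^ 2 * M.intercept s ^ 2)
    (h2 : M.kappa * (s'.1 + s'.2) = -M.intercept s * (1 - M.a ^ 2 * s'.1))
    {z : ℂ} (hz : z ≠ 0) :
    M.calPplus s z * M.calPminus s z = M.calPminus s' z * M.calPplus s' z := by
  have ha : (M.a : ℂ) ≠ 0 := by exact_mod_cast M.a_pos.ne'
  have hα : (M.α : ℂ) ≠ 0 := by exact_mod_cast M.α_pos.ne'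
  have hc : (M.intercept s : ℂ) ≠ 0 := by exact_mod_cast M.intercept_ne_zero hs
  have hc' : (M.intercept s' : ℂ) ≠ 0 := by exact_mod_cast M.intercept_ne_zero hs'
  have hx' : (s'.1 : ℂ) ≠ 0 := by exact_mod_cast hs'.2.ne
  have h3 : (M.a : ℂ) ^ 2 * (M.intercept s * M.intercept s') * (1 - M.a ^ 2 * s'.1) =
      s'.1 * (s'.1 - M.a ^ 2) := by exact_mod_cast M.intercept_mul hs' h2
  have h1' : (s.1 : ℂ) = M.a ^ 2 * M.intercept s ^ 2 / s'.1 := by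
    rw [eq_div_iff hx']
    exact_mod_cast h1
  simp only [calPplus, calPminus, bFun, M.aFun_eq, M.dFun_eq hs, M.dFun_eq hs']
  push_cast
  rw [h1']
  ext i j
  fin_cases i <;> fin_cases j <;>
    -- The cancellation lemmas are disabled, since they would turn the equations into disjunctions.
    simp [Matrix.mul_apply, Fin.sum_univ_two, -mul_eq_mul_left_iff, -mul_eq_mul_right_iff] <;>
    field_simp
  · linear_combination h3
  · ring
  · ring
  · linear_combination -h3

/-- The start point is the one at which $a(x,y)=a\alpha^2$, $d(x,y)=1/a$ and $b(x,y)=1/(\alpha a)$,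
which makes the product of the two factors equal to the symbol. -/
lemma P_eq {z : ℂ} (hz : z ≠ 0) :
    M.P z = M.calPminus (M.flow 0) z * M.calPplus (M.flow 0) z := by
  have ha : (M.a : ℂ) ≠ 0 := by exact_mod_cast M.a_pos.ne'
  have hα : (M.α : ℂ) ≠ 0 := by exact_mod_cast M.α_pos.ne'
  have hA : M.aFun (M.flow 0) = M.a * M.α ^ 2 := by
    have := M.α_pos
    have := M.a_pos
    have h1 : 1 - M.a ^ 2 * (-1) = 1 + M.a ^ 2 := by ring
    rw [flow_zero]
    simp only [aFun, h1]
    field_simp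
    ring
  have hd : M.dFun (M.flow 0) = 1 / M.a := by
    have h1 := M.dFun_eq (M.flow_mem_oval 0)
    have h2 := M.aFun_eq (s := M.flow 0)
    have := M.α_pos
    have := M.a_pos
    have h3 : M.intercept (M.flow 0) = M.α / M.a := by
      rw [hA] at h2
      field_simp
      apply mul_left_cancel₀ (mul_pos (M.α_pos) M.a_pos).ne'
      linear_combination -h2
    rw [h1, h3, flow_zero]
    field_simp
  have hb : M.bFun (M.flow 0) = 1 / (M.α * M.a) := by
    rw [flow_zero]
    simp only [bFun]
    field_simp
  simp only [P, calPminus, calPplus, hA, hd, hb]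
  push_cast
  ext i j
  fin_cases i <;> fin_cases j <;>
    simp [Matrix.mul_apply, Fin.sum_univ_two] <;>
    field_simp <;> ring

lemma Pminus_succ (k : ℕ) (z : ℂ) :
    M.Pminus (k + 1) z = M.Pminus k z * M.calPminus (M.flow k) z := by
  simp [Pminus, List.range_succ]

lemma Pplus_succ (k : ℕ) (z : ℂ) :
    M.Pplus (k + 1) z = M.calPplus (M.flow k) z * M.Pplus k z := by
  simp [Pplus, List.range_succ]

lemma calPplus_mul_calPminus_flow (k : ℕ) {z : ℂ} (hz : z ≠ 0) :
    M.calPplus (M.flow k) z * M.calPminus (M.flow k) z =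
      M.calPminus (M.flow (k + 1)) z * M.calPplus (M.flow (k + 1)) z :=
  M.calPplus_mul_calPminus (M.flow_mem_oval k) (M.flow_mem_oval (k + 1)) (M.flow_succ k).1
    (M.flow_succ k).2 hz

/-! ### Intertwining relations and commutation with the symbol -/

/-- Each step of the flow moves one more minus factor across:
$(P_{k,-}P_{k,+})P_{k,-}=P_{k,-}(P_{k+1,-}P_{k+1,+})$. -/
lemma P_mul_Pminus (k : ℕ) {z : ℂ} (hz : z ≠ 0) : M.P z * M.Pminus k z =
    M.Pminus k z * (M.calPminus (M.flow k) z * M.calPplus (M.flow k) z) := by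
  induction k with
  | zero => simp [Pminus, M.P_eq hz]
  | succ k ih =>
    rw [Pminus_succ, ← calPplus_mul_calPminus_flow _ _ hz, ← mul_assoc, ih]
    simp only [mul_assoc]

lemma Pplus_mul_P (k : ℕ) {z : ℂ} (hz : z ≠ 0) : M.Pplus k z * M.P z =
    M.calPminus (M.flow k) z * M.calPplus (M.flow k) z * M.Pplus k z := by
  induction k with
  | zero => simp [Pplus, M.P_eq hz]
  | succ k ih =>
    rw [Pplus_succ, ← calPplus_mul_calPminus_flow _ _ hz, mul_assoc, ih]
    simp only [mul_assoc]

/-- A further factor $P$ on the left passes through $P_-^{(k)}$ and becomes $P_{k,-}P_{k,+}$,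
exactly the two factors that extend both products. -/
lemma P_pow (k : ℕ) {z : ℂ} (hz : z ≠ 0) : M.P z ^ k = M.Pminus k z * M.Pplus k z := by
  induction k with
  | zero => simp [Pminus, Pplus]
  | succ k ih =>
    rw [pow_succ', ih, ← mul_assoc, M.P_mul_Pminus k hz, Pminus_succ, Pplus_succ]
    simp only [mul_assoc]

/-- After a full period the factor $P_{d,-}P_{d,+}$ produced by the intertwining is $P$ itself. -/
lemma commute_Pminus {z : ℂ} (hz : z ≠ 0) :
    Commute (M.P z) (M.Pminus (addOrderOf M.shiftPoint) z) := by
  have := M.P_mul_Pminus (addOrderOf M.shiftPoint) hz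
  rwa [flow_addOrderOf, ← M.P_eq hz] at this

lemma commute_Pplus {z : ℂ} (hz : z ≠ 0) :
    Commute (M.P z) (M.Pplus (addOrderOf M.shiftPoint) z) := by
  have := M.Pplus_mul_P (addOrderOf M.shiftPoint) hz
  rw [flow_addOrderOf, ← M.P_eq hz] at this
  exact this.symm

/-! ### Determinants of the factors and of their products -/

lemma det_calPminus {s : ℝ × ℝ} (hs : s ∈ M.oval) :
    ∃ C : ℂ, C ≠ 0 ∧ ∀ z, (M.calPminus s z).det = C * (1 - M.a ^ 2 / z) := by
  have hA : M.aFun s ≠ 0 := by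
    rw [aFun_eq]
    exact mul_ne_zero (mul_ne_zero (pow_ne_zero 2 M.a_pos.ne') M.α_pos.ne')
      (M.intercept_ne_zero hs)
  have hb : M.bFun s ≠ 0 :=
    neg_ne_zero.mpr (one_div_ne_zero
      (mul_ne_zero (mul_ne_zero M.α_pos.ne' M.a_pos.ne') hs.2.ne))
  refine ⟨M.bFun s ^ 2 * M.aFun s ^ 2, by exact_mod_cast by positivity, fun z => ?_⟩
  simp only [calPminus, Matrix.det_smul, Matrix.det_mul, Matrix.det_fin_two_of, Fintype.card_fin]
  ring

lemma det_calPplus {s : ℝ × ℝ} (hs : s ∈ M.oval) :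
    ∃ C : ℂ, C ≠ 0 ∧ ∀ z, (M.calPplus s z).det = C * (1 - M.a ^ 2 * z) := by
  have hd : M.dFun s ≠ 0 := by
    rw [M.dFun_eq hs]
    exact div_ne_zero (neg_ne_zero.mpr (mul_ne_zero M.α_pos.ne' hs.2.ne))
      (mul_ne_zero (pow_ne_zero 2 M.a_pos.ne') (M.intercept_ne_zero hs))
  have ha := M.a_pos
  have hα := M.α_pos
  refine ⟨M.a ^ 2 / M.α ^ 2 * M.dFun s ^ 2, by exact_mod_cast by positivity, fun z => ?_⟩
  simp only [calPplus, Matrix.det_mul, Matrix.det_fin_two_of]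
  ring

lemma det_Pminus (k : ℕ) :
    ∃ C : ℂ, C ≠ 0 ∧ ∀ z, (M.Pminus k z).det = C * (1 - M.a ^ 2 / z) ^ k := by
  induction k with
  | zero => exact ⟨1, one_ne_zero, fun z => by simp [Pminus]⟩
  | succ k ih =>
    obtain ⟨C, hC, h⟩ := ih
    obtain ⟨D, hD, h'⟩ := M.det_calPminus (M.flow_mem_oval k)
    exact ⟨C * D, mul_ne_zero hC hD, fun z => by rw [Pminus_succ, Matrix.det_mul, h, h']; ring⟩

lemma det_Pplus (k : ℕ) :
    ∃ C : ℂ, C ≠ 0 ∧ ∀ z, (M.Pplus k z).det = C * (1 - M.a ^ 2 * z) ^ k := by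
  induction k with
  | zero => exact ⟨1, one_ne_zero, fun z => by simp [Pplus]⟩
  | succ k ih =>
    obtain ⟨C, hC, h⟩ := ih
    obtain ⟨D, hD, h'⟩ := M.det_calPplus (M.flow_mem_oval k)
    exact ⟨C * D, mul_ne_zero hC hD, fun z => by rw [Pplus_succ, Matrix.det_mul, h, h']; ring⟩

/-! ### Rational functions without poles outside `0` and `∞` -/

/-- `h` is analytic on `ℂ \ {0}` and meromorphic at `0` and `∞`. -/
structure IsLaurent (h : ℂ → ℂ) : Prop where
  analyticAt : ∀ z ≠ 0, AnalyticAt ℂ h z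
  meromorphicAt_zero : MeromorphicAt h 0
  meromorphicAt_infty : MeromorphicAt (fun s => h s⁻¹) 0

variable {M}

lemma IsLaurent.const (c : ℂ) : IsLaurent fun _ => c :=
  ⟨fun _ _ => analyticAt_const, .const _ _, .const _ _⟩

lemma IsLaurent.id : IsLaurent fun z => z :=
  ⟨fun _ _ => analyticAt_id, .id _, (MeromorphicAt.id _).inv⟩

lemma IsLaurent.inv : IsLaurent fun z => z⁻¹ :=
  ⟨fun _ hz => analyticAt_id.inv hz, (MeromorphicAt.id _).inv, by
    simp only [inv_inv]; exact MeromorphicAt.id _⟩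

lemma IsLaurent.add {f g : ℂ → ℂ} (hf : IsLaurent f) (hg : IsLaurent g) :
    IsLaurent fun z => f z + g z :=
  ⟨fun z hz => (hf.1 z hz).add (hg.1 z hz), hf.2.add hg.2, hf.3.add hg.3⟩

lemma IsLaurent.mul {f g : ℂ → ℂ} (hf : IsLaurent f) (hg : IsLaurent g) :
    IsLaurent fun z => f z * g z :=
  ⟨fun z hz => (hf.1 z hz).mul (hg.1 z hz), hf.2.mul hg.2, hf.3.mul hg.3⟩

lemma IsLaurent.sub {f g : ℂ → ℂ} (hf : IsLaurent f) (hg : IsLaurent g) :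
    IsLaurent fun z => f z - g z :=
  ⟨fun z hz => (hf.1 z hz).sub (hg.1 z hz), hf.2.sub hg.2, hf.3.sub hg.3⟩

/-- The entries of the matrix function `N` are Laurent. -/
def IsLaurentMatrix (N : ℂ → Matrix (Fin 2) (Fin 2) ℂ) : Prop :=
  ∀ i j, IsLaurent fun z => N z i j

lemma IsLaurentMatrix.mul {N N' : ℂ → Matrix (Fin 2) (Fin 2) ℂ} (h : IsLaurentMatrix N)
    (h' : IsLaurentMatrix N') : IsLaurentMatrix fun z => N z * N' z := by
  intro i j
  simp only [Matrix.mul_apply, Fin.sum_univ_two]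
  exact ((h _ _).mul (h' _ _)).add ((h _ _).mul (h' _ _))

lemma IsLaurentMatrix.const (A : Matrix (Fin 2) (Fin 2) ℂ) : IsLaurentMatrix fun _ => A :=
  fun _ _ => .const _

lemma isLaurentMatrix_of {f₁ f₂ f₃ f₄ : ℂ → ℂ} (h₁ : IsLaurent f₁) (h₂ : IsLaurent f₂)
    (h₃ : IsLaurent f₃) (h₄ : IsLaurent f₄) :
    IsLaurentMatrix fun z => !![f₁ z, f₂ z; f₃ z, f₄ z] := by
  intro i j
  fin_cases i <;> fin_cases j <;> assumption

variable (M)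

lemma isLaurentMatrix_calPminus (s : ℝ × ℝ) : IsLaurentMatrix (M.calPminus s) := by
  have h := ((IsLaurentMatrix.const !![(M.aFun s : ℂ), 0; 0, 1]).mul
    (isLaurentMatrix_of (.const 1) (.const 1) ((IsLaurent.const (M.a ^ 2)).mul .inv)
      (.const 1))).mul (IsLaurentMatrix.const !![1, 0; 0, (M.aFun s : ℂ)])
  exact fun i j => (IsLaurent.const (M.bFun s)).mul (h i j)

lemma isLaurentMatrix_calPplus (s : ℝ × ℝ) : IsLaurentMatrix (M.calPplus s) :=
  ((IsLaurentMatrix.const _).mul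
    (isLaurentMatrix_of (.const 1) ((IsLaurent.const (M.a ^ 2)).mul .id) (.const 1)
      (.const 1))).mul (IsLaurentMatrix.const _)

lemma isLaurentMatrix_Pminus (k : ℕ) : IsLaurentMatrix (M.Pminus k) := by
  induction k with
  | zero => exact .const _
  | succ k ih =>
    simp only [IsLaurentMatrix, Pminus_succ]
    exact ih.mul (M.isLaurentMatrix_calPminus _)

lemma isLaurentMatrix_Pplus (k : ℕ) : IsLaurentMatrix (M.Pplus k) := by
  induction k with
  | zero => exact .const _
  | succ k ih =>
    simp only [IsLaurentMatrix, Pplus_succ]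
    exact (M.isLaurentMatrix_calPplus _).mul ih

/-! ### Matrices commuting with the symbol -/

/-- The difference of the (constant) diagonal entries of `P`. -/
def diagDiff : ℂ := (M.a ^ 2 + 1) * (1 / M.α - M.α)

lemma diagDiff_ne_zero : M.diagDiff ≠ 0 := by
  have hα := M.α_pos
  have h : 0 < (M.a ^ 2 + 1) * (1 / M.α - M.α) := by
    have h1 : M.α < 1 / M.α := by
      rw [lt_div_iff₀ hα]
      nlinarith [M.α_lt_one]
    exact mul_pos (by positivity) (by linarith)
  unfold diagDiff
  exact_mod_cast h.ne'

lemma P_apply (z : ℂ) (hz : z ≠ 0) : M.P z = !![(M.α : ℂ) * (M.a ^ 2 + 1), M.a * M.α * (1 + z);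
    M.a / M.α * (1 + 1 / z), M.α * (M.a ^ 2 + 1) + M.diagDiff] := by
  have hα : (M.α : ℂ) ≠ 0 := by exact_mod_cast M.α_pos.ne'
  unfold P diagDiff
  ext i j
  fin_cases i <;> fin_cases j <;> simp [Matrix.mul_apply, Fin.sum_univ_two] <;> field_simp <;> ring

/-- The eigenvalue, at the point `w = (z, v)` of the curve, of a matrix `N z` that commutes with
`P z`. -/
def eigenvalue (N : ℂ → Matrix (Fin 2) (Fin 2) ℂ) (w : ℂ × ℂ) : ℂ :=
  N w.1 0 0 + (N w.1 1 1 - N w.1 0 0) / M.diagDiff *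
    (M.T / 2 + w.2 / w.1 / 2 - M.α * (M.a ^ 2 + 1))

/-- The off-diagonal entries of $PN=NP$ read $(P_{11}-P_{00})N_{ij}=(N_{11}-N_{00})P_{ij}$, and
$P_{11}-P_{00}$ is a nonzero constant. No genericity of $z$ is needed, so branch points and $z=-1$
are included. -/
lemma eq_of_commute {z : ℂ} (hz : z ≠ 0) {N : Matrix (Fin 2) (Fin 2) ℂ}
    (h : Commute (M.P z) N) :
    N = (N 0 0 - (N 1 1 - N 0 0) / M.diagDiff * (M.α * (M.a ^ 2 + 1))) • 1 +
      ((N 1 1 - N 0 0) / M.diagDiff) • M.P z := by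
  have hD := M.diagDiff_ne_zero
  have h' := h.eq
  rw [M.P_apply z hz] at h'
  have h01 := congrFun (congrFun h' 0) 1
  have h10 := congrFun (congrFun h' 1) 0
  simp only [Matrix.mul_apply, Fin.sum_univ_two, Matrix.of_apply, Matrix.cons_val',
    Matrix.cons_val_zero, Matrix.cons_val_one, Matrix.cons_val_fin_one] at h01 h10
  ext i j
  rw [M.P_apply z hz]
  fin_cases i <;> fin_cases j <;>
    simp only [Matrix.add_apply, Matrix.smul_apply, Fin.zero_eta, Fin.mk_one, Matrix.one_apply,
      Matrix.of_apply, Matrix.cons_val', Matrix.cons_val_zero, Matrix.cons_val_one,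
      Matrix.cons_val_fin_one, smul_eq_mul, if_true, one_ne_zero, zero_ne_one, if_false]
  · ring
  · field_simp
    linear_combination -h01
  -- The off-diagonal entry stays opaque, so that clearing denominators does not expand it.
  · generalize (M.a : ℂ) / M.α * (1 + 1 / z) = c at h10
    field_simp
    linear_combination h10
  · field_simp
    ring

lemma lam_coe {p : M.Curve} (hz : p.1.1 ≠ 0) : M.lam p = M.T / 2 + p.1.2 / p.1.1 / 2 := by
  simp [lam, hz]

lemma lam_char {p : M.Curve} (hz : p.1.1 ≠ 0) :
    M.lam p ^ 2 - M.T * M.lam p + (1 - M.a ^ 2 * p.1.1) * (1 - M.a ^ 2 / p.1.1) = 0 := by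
  have h := p.2
  rw [M.cubic_eq_sq_mul_R _ hz] at h
  have hT : (M.T : ℂ) ^ 2 = (M.α + 1 / M.α) ^ 2 * (1 + M.a ^ 2) ^ 2 := by
    unfold T; push_cast; ring
  have h2 : (p.1.2 / p.1.1) ^ 2 = M.R p.1.1 := by
    rw [div_pow, h]; field_simp
  rw [R, ← hT] at h2
  rw [M.lam_coe hz]
  linear_combination h2 / 4

lemma mulVec_of_commute {p : M.Curve} (hz : p.1.1 ≠ 0) {N : ℂ → Matrix (Fin 2) (Fin 2) ℂ}
    (h : Commute (M.P p.1.1) (N p.1.1)) {v : Fin 2 → ℂ}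
    (hv : (M.P p.1.1).mulVec v = M.lam p • v) :
    (N p.1.1).mulVec v = M.eigenvalue N p.1 • v := by
  rw [M.eq_of_commute hz h, Matrix.add_mulVec, Matrix.smul_mulVec, Matrix.smul_mulVec, hv,
    Matrix.one_mulVec, smul_smul, ← add_smul, eigenvalue, M.lam_coe hz]
  congr 1
  ring

lemma exists_eigenvector {p : M.Curve} (hz : p.1.1 ≠ 0) :
    ∃ v ≠ 0, (M.P p.1.1).mulVec v = M.lam p • v := by
  have h := M.det_P_sub p.1.1 (M.lam p) hz
  rw [M.lam_char hz] at h
  obtain ⟨v, hv, h⟩ := Matrix.exists_mulVec_eq_zero_iff.mpr h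
  refine ⟨v, hv, ?_⟩
  rwa [Matrix.sub_mulVec, Matrix.smul_mulVec, Matrix.one_mulVec, sub_eq_zero] at h

lemma det_sub_eigenvalue {p : M.Curve} (hz : p.1.1 ≠ 0) {N : ℂ → Matrix (Fin 2) (Fin 2) ℂ}
    (h : Commute (M.P p.1.1) (N p.1.1)) :
    (N p.1.1 - M.eigenvalue N p.1 • (1 : Matrix (Fin 2) (Fin 2) ℂ)).det = 0 := by
  obtain ⟨v, hv, hP⟩ := M.exists_eigenvector hz
  refine Matrix.exists_mulVec_eq_zero_iff.mp ⟨v, hv, ?_⟩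
  rw [Matrix.sub_mulVec, Matrix.smul_mulVec, Matrix.one_mulVec, M.mulVec_of_commute hz h hP,
    sub_self]

/-- Both sides are the eigenvalue of $P^k=NN'$ on a common eigenvector. -/
lemma lam_pow_eq {p : M.Curve} (hz : p.1.1 ≠ 0) {N N' : ℂ → Matrix (Fin 2) (Fin 2) ℂ} {k : ℕ}
    (h : Commute (M.P p.1.1) (N p.1.1)) (h' : Commute (M.P p.1.1) (N' p.1.1))
    (hk : M.P p.1.1 ^ k = N p.1.1 * N' p.1.1) :
    M.lam p ^ k = M.eigenvalue N p.1 * M.eigenvalue N' p.1 := by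
  obtain ⟨v, hv, hP⟩ := M.exists_eigenvector hz
  have h1 : ∀ n : ℕ, (M.P p.1.1 ^ n).mulVec v = M.lam p ^ n • v := by
    intro n
    induction n with
    | zero => simp
    | succ n ih =>
      rw [pow_succ, ← Matrix.mulVec_mulVec, hP, Matrix.mulVec_smul, ih, smul_smul, pow_succ']
  have h2 := h1 k
  rw [hk, ← Matrix.mulVec_mulVec, M.mulVec_of_commute hz h' hP, Matrix.mulVec_smul,
    M.mulVec_of_commute hz h hP, smul_smul, mul_comm] at h2
  exact (smul_left_injective ℂ hv h2).symm

/-- Changing the sign of $v$ exchanges the two roots $\lambda$, so the product is $\det(x+yP)$ for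
$N=x+yP$. Working with the entries keeps the identity valid at branch points, where there may be
only one eigenvector direction. -/
lemma eigenvalue_mul_neg {p : M.Curve} (hz : p.1.1 ≠ 0) {N : ℂ → Matrix (Fin 2) (Fin 2) ℂ}
    (h : Commute (M.P p.1.1) (N p.1.1)) :
    M.eigenvalue N p.1 * M.eigenvalue N (p.1.1, -p.1.2) = (N p.1.1).det := by
  have h1 := M.lam_char hz
  rw [M.lam_coe hz] at h1
  have hT : (M.T : ℂ) = 2 * (M.α * (M.a ^ 2 + 1)) + M.diagDiff := by
    unfold T diagDiff; push_cast; ring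
  have hα : (M.α : ℂ) ≠ 0 := by exact_mod_cast M.α_pos.ne'
  have h2 : M.P p.1.1 0 1 * M.P p.1.1 1 0 = (M.α * (M.a ^ 2 + 1)) *
      (M.α * (M.a ^ 2 + 1) + M.diagDiff) - (1 - M.a ^ 2 * p.1.1) * (1 - M.a ^ 2 / p.1.1) := by
    rw [M.P_apply _ hz]
    simp only [Matrix.of_apply, Matrix.cons_val', Matrix.cons_val_zero, Matrix.cons_val_one,
      Matrix.cons_val_fin_one, diagDiff]
    field_simp
    ring
  have h3 : N p.1.1 0 1 = (N p.1.1 1 1 - N p.1.1 0 0) / M.diagDiff * M.P p.1.1 0 1 := by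
    have := congrFun (congrFun (M.eq_of_commute hz h) 0) 1
    simpa using this
  have h4 : N p.1.1 1 0 = (N p.1.1 1 1 - N p.1.1 0 0) / M.diagDiff * M.P p.1.1 1 0 := by
    have := congrFun (congrFun (M.eq_of_commute hz h) 1) 0
    simpa using this
  have h5 : N p.1.1 1 1 = N p.1.1 0 0 +
      (N p.1.1 1 1 - N p.1.1 0 0) / M.diagDiff * M.diagDiff := by
    rw [div_mul_cancel₀ _ M.diagDiff_ne_zero]; ring
  rw [Matrix.det_fin_two, h3, h4, eigenvalue, eigenvalue]
  simp only [neg_div]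
  generalize (N p.1.1 1 1 - N p.1.1 0 0) / M.diagDiff = g at *
  rw [h5]
  generalize p.1.2 / p.1.1 = r at *
  rw [hT] at h1 ⊢
  linear_combination g ^ 2 * h2 - g ^ 2 * h1

/-! ### Meromorphic functions on the surface -/

lemma eventually_chart_symm_ne (x y : M.Surface) :
    ∀ᶠ t in 𝓝[≠] (M.chart x x), (M.chart x).symm t ≠ y := by
  have hx : x ∈ (M.chart x).source := mem_chart_source ℂ x
  by_cases h : x = y
  · subst h
    filter_upwards [self_mem_nhdsWithin, mem_nhdsWithin_of_mem_nhds
      ((M.chart x).open_target.mem_nhds ((M.chart x).map_source hx))] with t ht ht' heq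
    apply ht
    rw [Set.mem_singleton_iff, ← (M.chart x).right_inv ht', heq]
  · apply eventually_nhdsWithin_of_eventually_nhds
    have hc := (M.chart x).continuousAt_symm ((M.chart x).map_source hx)
    rw [ContinuousAt, (M.chart x).left_inv hx] at hc
    exact hc.eventually_ne h

lemma eventually_chart_symm_ne_nhds {x y : M.Surface} (h : x ≠ y) :
    ∀ᶠ t in 𝓝 (M.chart x x), (M.chart x).symm t ≠ y := by
  have hx : x ∈ (M.chart x).source := mem_chart_source ℂ x
  have hc := (M.chart x).continuousAt_symm ((M.chart x).map_source hx)
  rw [ContinuousAt, (M.chart x).left_inv hx] at hc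
  exact hc.eventually_ne h

open Classical in
/-- The modification of `h` at the points over `0` and `∞` that takes the analytic value there
if `h` has no pole, and the value `0` otherwise. -/
def normalForm (h : M.Surface → ℂ) (x : M.Surface) : ℂ :=
  if x = M.origin ∨ x = ∞ then toMeromorphicNFAt (h ∘ (M.chart x).symm) (M.chart x x) (M.chart x x)
  else h x

variable {M}

lemma normalForm_of_ne {h : M.Surface → ℂ} {x : M.Surface} (h0 : x ≠ M.origin) (h1 : x ≠ ∞) :
    M.normalForm h x = h x := by
  simp [normalForm, h0, h1]

lemma normalForm_eventuallyEq (h : M.Surface → ℂ) (x : M.Surface) :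
    M.normalForm h ∘ (M.chart x).symm =ᶠ[𝓝[≠] (M.chart x x)] h ∘ (M.chart x).symm := by
  filter_upwards [M.eventually_chart_symm_ne x M.origin, M.eventually_chart_symm_ne x ∞]
    with t h0 h1
  exact normalForm_of_ne h0 h1

lemma orderAtPoint_normalForm (h : M.Surface → ℂ) (x : M.Surface) :
    orderAtPoint (M.normalForm h) x = orderAtPoint h x :=
  meromorphicOrderAt_congr (normalForm_eventuallyEq h x)

/-- Changing values at the two points over $0$ and $\infty$ affects no punctured germ. Away from
these points the function is already analytic, hence in normal form. -/
lemma isMeromorphicFunction_normalForm {h : M.Surface → ℂ}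
    (hmero : ∀ x, MeromorphicAt (h ∘ (M.chart x).symm) (M.chart x x))
    (hana : ∀ x, x ≠ M.origin → x ≠ ∞ → AnalyticAt ℂ (h ∘ (M.chart x).symm) (M.chart x x)) :
    IsMeromorphicFunction (M.normalForm h) := by
  intro x
  change MeromorphicNFAt (M.normalForm h ∘ (M.chart x).symm) (M.chart x x)
  by_cases hx : x = M.origin ∨ x = ∞
  · refine (meromorphicNFAt_congr ?_).mpr
      (meromorphicNFAt_toMeromorphicNFAt (f := h ∘ (M.chart x).symm) (x := M.chart x x))
    have h1 := (normalForm_eventuallyEq h x).trans (hmero x).eq_nhdsNE_toMeromorphicNFAt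
    refine eventuallyEq_nhds_of_eventuallyEq_nhdsNE h1 ?_
    rw [Function.comp_apply, (M.chart x).left_inv (mem_chart_source ℂ x)]
    simp [normalForm, hx]
  · push Not at hx
    refine (meromorphicNFAt_congr ?_).mpr (hana x hx.1 hx.2).meromorphicNFAt
    filter_upwards [M.eventually_chart_symm_ne_nhds hx.1, M.eventually_chart_symm_ne_nhds hx.2]
      with t h0 h1
    exact normalForm_of_ne h0 h1

variable (M)

/-- The eigenvalue of `N` as a function on the surface. -/
def eigenvalueFun (N : ℂ → Matrix (Fin 2) (Fin 2) ℂ) : M.Surface → ℂ :=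
  fun x => x.elim 0 fun p => M.eigenvalue N p.1

lemma eigenvalueFun_coe (N : ℂ → Matrix (Fin 2) (Fin 2) ℂ) (p : M.Curve) :
    M.eigenvalueFun N p = M.eigenvalue N p.1 := rfl

variable {M}

lemma coe_ne_origin {p : M.Curve} (hz : p.1.1 ≠ 0) : (p : M.Surface) ≠ M.origin := by
  intro h
  have := OnePoint.coe_injective h
  exact hz (by rw [this])

lemma exists_of_ne {x : M.Surface} (h0 : x ≠ M.origin) (h1 : x ≠ ∞) :
    ∃ p : M.Curve, x = p ∧ p.1.1 ≠ 0 := by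
  induction x using OnePoint.rec with
  | infty => exact absurd rfl h1
  | coe p =>
    refine ⟨p, rfl, fun hz => h0 ?_⟩
    have hv := p.2
    rw [hz] at hv
    have : p.1.2 = 0 := by simpa [cubic] using hv
    exact congrArg _ (Subtype.ext (Prod.ext hz this))

section eigenvalueFun

variable {N : ℂ → Matrix (Fin 2) (Fin 2) ℂ}

lemma analyticAt_eigenvalue (hN : IsLaurentMatrix N) {z v : ℂ → ℂ} {t : ℂ} (hz : AnalyticAt ℂ z t)
    (hv : AnalyticAt ℂ v t) (h0 : z t ≠ 0) :
    AnalyticAt ℂ (fun s => M.eigenvalue N (z s, v s)) t := by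
  have h (i j) : AnalyticAt ℂ (fun s => N (z s) i j) t :=
    AnalyticAt.comp (g := fun w => N w i j) ((hN i j).analyticAt _ h0) hz
  exact (h 0 0).add (((h 1 1).sub (h 0 0)).div_const.mul
    ((analyticAt_const.add (hv.div hz h0).div_const).sub analyticAt_const))

lemma meromorphicAt_eigenvalue {z v : ℂ → ℂ} {t : ℂ}
    (hN : ∀ i j, MeromorphicAt (fun s => N (z s) i j) t) (hz : MeromorphicAt z t)
    (hv : MeromorphicAt v t) :
    MeromorphicAt (fun s => M.eigenvalue N (z s, v s)) t :=
  (hN 0 0).add ((((hN 1 1).sub (hN 0 0)).div (.const _ _)).mul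
    (((MeromorphicAt.const _ _).add ((hv.div hz).div (.const _ _))).sub (.const _ _)))

lemma analyticAt_eigenvalueFun (hN : IsLaurentMatrix N) {p : M.Curve} (hz : p.1.1 ≠ 0) :
    AnalyticAt ℂ (M.eigenvalueFun N ∘ (M.chart p).symm) (M.chart p p) := by
  have hp : (p : M.Surface) ∈ (M.chart p).source := mem_chart_source ℂ (p : M.Surface)
  have hl := (M.chart p).left_inv hp
  obtain ⟨g, hg, hge⟩ := M.chart_symm_analytic p ((M.chart p).map_source hp)
    (by rw [hl]; exact OnePoint.coe_ne_infty p)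
  have h0 : g (M.chart p p) = p := by
    have := hge.self_of_nhds
    rw [hl] at this
    exact (OnePoint.coe_injective this).symm
  have h1 : AnalyticAt ℂ (fun s => M.eigenvalue N ((g s).1.1, (g s).1.2)) (M.chart p p) :=
    analyticAt_eigenvalue hN (analyticAt_fst.comp hg) (analyticAt_snd.comp hg) (by rwa [h0])
  refine h1.congr ?_
  filter_upwards [hge] with s hs
  rw [Function.comp_apply, hs, eigenvalueFun_coe]

lemma orderAtPoint_eigenvalueFun_eq_zero (hN : IsLaurentMatrix N) {p : M.Curve} (hz : p.1.1 ≠ 0)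
    (hne : M.eigenvalue N p.1 ≠ 0) : orderAtPoint (M.eigenvalueFun N) p = 0 := by
  have h := analyticAt_eigenvalueFun hN hz
  change meromorphicOrderAt (M.eigenvalueFun N ∘ (M.chart p).symm) (M.chart p p) = 0
  rw [← tendsto_ne_zero_iff_meromorphicOrderAt_eq_zero h.meromorphicAt]
  refine ⟨_, ?_, h.continuousAt.tendsto.mono_left nhdsWithin_le_nhds⟩
  rwa [Function.comp_apply, (M.chart p).left_inv (mem_chart_source ℂ (p : M.Surface))]

/-- A function with `F(t) F(-t)` of order `2m` at `0` has order `m` there. -/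
lemma meromorphicOrderAt_of_mul_neg {F k : ℂ → ℂ} (hF : MeromorphicAt F 0)
    (h : ∀ t ≠ 0, F t * F (-t) = k t) {m : ℤ} (hk : meromorphicOrderAt k 0 = (2 * m : ℤ)) :
    meromorphicOrderAt F 0 = m := by
  have hneg : AnalyticAt ℂ (fun t : ℂ => -t) 0 := analyticAt_id.neg
  have hd : deriv (fun t : ℂ => -t) 0 ≠ 0 := by simp
  have h1 : meromorphicOrderAt (F ∘ fun t => -t) 0 = meromorphicOrderAt F 0 := by
    rw [meromorphicOrderAt_comp_of_deriv_ne_zero hneg hd, neg_zero]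
  have h2 : MeromorphicAt (F ∘ fun t => -t) 0 :=
    MeromorphicAt.comp_analyticAt (by rwa [neg_zero]) hneg
  -- The substitution $t\mapsto-t$ preserves the order at $0$, so the order of the product is twice
  -- that of `F`.
  have h3 : meromorphicOrderAt k 0 = meromorphicOrderAt F 0 + meromorphicOrderAt F 0 := by
    nth_rewrite 2 [← h1]
    rw [← meromorphicOrderAt_mul hF h2]
    apply meromorphicOrderAt_congr
    filter_upwards [self_mem_nhdsWithin] with t ht
    exact (h t ht).symm
  rw [hk] at h3
  cases ho : meromorphicOrderAt F 0 with
  | top => rw [ho] at h3; exact absurd h3 (WithTop.coe_ne_top)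
  | coe n =>
    rw [ho] at h3
    norm_cast at h3 ⊢
    omega

lemma chart_coe_apply (p q : M.Curve) : M.chart p q = M.curveChart p q := by
  rw [chart_coe, OpenPartialHomeomorph.lift_openEmbedding_apply]

lemma chart_origin : M.chart M.origin M.origin = 0 := by
  rw [origin, chart_coe_apply, curveChart, dif_pos rfl]
  simp [branchChart]

/-- In this parametrization $z$ is even and $v$ is odd in $t$, so $t\mapsto-t$ exchanges the sheets.
-/
lemma chart_origin_symm (t : ℂ) : ∃ h, (M.chart M.origin).symm t = ((⟨(t ^ 2 / M.quot 0 0,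
    t * csqrt (M.quot 0 (t ^ 2 / M.quot 0 0) / M.quot 0 0)), h⟩ : M.Curve) : M.Surface) := by
  have h := M.branch_mem 0 (by simp [cubic]) t
  rw [zero_add] at h
  refine ⟨h, ?_⟩
  change (((M.curveChart ⟨(0, 0), _⟩).symm t : M.Curve) : M.Surface) = _
  rw [curveChart, dif_pos rfl]
  congr 1
  apply Subtype.ext
  simp [branchChart]

lemma quot_zero_ne_zero : M.quot 0 0 ≠ 0 := M.quot_self_ne_zero (by simp [cubic])

/-- The product of the values at $t$ and $-t$ is the determinant, so its order in $t$ is twice the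
order sought; hence the hypothesis with $2m$. -/
lemma eigenvalueFun_origin (hN : IsLaurentMatrix N)
    (hcomm : ∀ z ≠ 0, Commute (M.P z) (N z)) :
    MeromorphicAt (M.eigenvalueFun N ∘ (M.chart M.origin).symm) (M.chart M.origin M.origin) ∧
    ∀ m : ℤ, meromorphicOrderAt (fun t => (N (t ^ 2 / M.quot 0 0)).det) 0 = (2 * m : ℤ) →
      orderAtPoint (M.eigenvalueFun N) M.origin = m := by
  have hq := quot_zero_ne_zero (M := M)
  set F : ℂ → ℂ := fun t => M.eigenvalue N (t ^ 2 / M.quot 0 0,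
    t * csqrt (M.quot 0 (t ^ 2 / M.quot 0 0) / M.quot 0 0))
  have hF : M.eigenvalueFun N ∘ (M.chart M.origin).symm = F := by
    ext t
    obtain ⟨h, heq⟩ := chart_origin_symm (M := M) t
    rw [Function.comp_apply, heq, eigenvalueFun_coe]
  have hz : AnalyticAt ℂ (fun t : ℂ => t ^ 2 / M.quot 0 0) 0 := (analyticAt_id.pow 2).div_const
  have hz0 : (0 : ℂ) ^ 2 / M.quot 0 0 = 0 := by simp
  have hw : AnalyticAt ℂ (fun t : ℂ => M.quot 0 (t ^ 2 / M.quot 0 0) / M.quot 0 0) 0 :=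
    (AnalyticAt.comp (g := M.quot 0) (M.analyticAt_quot 0 _) hz).div_const
  have hc : AnalyticAt ℂ (fun t : ℂ => csqrt (M.quot 0 (t ^ 2 / M.quot 0 0) / M.quot 0 0)) 0 :=
    AnalyticAt.comp (g := csqrt) (csqrt_analyticAt (by
      rw [hz0, div_self hq]; exact one_mem_slitPlane)) hw
  have hmero : MeromorphicAt F 0 := by
    refine meromorphicAt_eigenvalue (fun i j => ?_) hz.meromorphicAt
      (analyticAt_id.mul hc).meromorphicAt
    exact MeromorphicAt.comp_analyticAt (f := fun w => N w i j)
      (by rw [hz0]; exact (hN i j).meromorphicAt_zero) hz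
  refine ⟨by rwa [hF, chart_origin], fun m hm => ?_⟩
  change meromorphicOrderAt (M.eigenvalueFun N ∘ (M.chart M.origin).symm)
    (M.chart M.origin M.origin) = m
  rw [hF, chart_origin]
  refine meromorphicOrderAt_of_mul_neg hmero (fun t ht => ?_) hm
  have hz' : t ^ 2 / M.quot 0 0 ≠ 0 := div_ne_zero (pow_ne_zero 2 ht) hq
  obtain ⟨h, -⟩ := chart_origin_symm (M := M) t
  have := M.eigenvalue_mul_neg (p := ⟨_, h⟩) hz' (hcomm _ hz')
  simp only [F, neg_sq, neg_mul]
  exact this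

lemma eigenvalueFun_infty (hN : IsLaurentMatrix N)
    (hcomm : ∀ z ≠ 0, Commute (M.P z) (N z)) :
    MeromorphicAt (M.eigenvalueFun N ∘ (M.chart ∞).symm) (M.chart ∞ ∞) ∧
    ∀ m : ℤ, meromorphicOrderAt (fun t => (N (1 / t ^ 2)).det) 0 = (2 * m : ℤ) →
      orderAtPoint (M.eigenvalueFun N) ∞ = m := by
  set F : ℂ → ℂ := fun t => M.eigenvalue N (1 / t ^ 2, csqrt (M.recip (t ^ 2)) / t ^ 3)
  -- Equality is claimed only for $t\ne0$: at $t=0$ the left side is the default value at $\infty$,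
  -- while the right side divides by zero.
  have hF : M.eigenvalueFun N ∘ (M.chart ∞).symm =ᶠ[𝓝[≠] 0] F := by
    filter_upwards [self_mem_nhdsWithin] with t ht
    change M.eigenvalueFun N (M.inftyParam t) = _
    rw [M.inftyParam_of_ne ht, eigenvalueFun_coe, nearInfty]
  have hz : AnalyticAt ℂ (fun t : ℂ => t ^ 2) 0 := analyticAt_id.pow 2
  have hc : AnalyticAt ℂ (fun t : ℂ => csqrt (M.recip (t ^ 2))) 0 :=
    AnalyticAt.comp (g := csqrt) (csqrt_analyticAt (by
      rw [zero_pow two_ne_zero]; exact M.recip_zero_mem))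
      (AnalyticAt.comp (g := M.recip) (M.analyticAt_recip _) hz)
  have hmero : MeromorphicAt F 0 := by
    refine meromorphicAt_eigenvalue (fun i j => ?_)
      ((MeromorphicAt.const _ _).div hz.meromorphicAt)
      (hc.meromorphicAt.div (analyticAt_id.pow 3).meromorphicAt)
    have := MeromorphicAt.comp_analyticAt (f := fun s => N s⁻¹ i j)
      (by rw [zero_pow two_ne_zero]; exact (hN i j).meromorphicAt_infty) hz
    simp only [one_div]
    exact this
  refine ⟨hmero.congr hF.symm, fun m hm => ?_⟩
  change meromorphicOrderAt (M.eigenvalueFun N ∘ (M.chart ∞).symm) 0 = m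
  rw [meromorphicOrderAt_congr hF]
  refine meromorphicOrderAt_of_mul_neg hmero (fun t ht => ?_) hm
  have hz' : 1 / t ^ 2 ≠ 0 := one_div_ne_zero (pow_ne_zero 2 ht)
  have := M.eigenvalue_mul_neg (p := M.nearInfty t) hz' (hcomm _ hz')
  -- At infinity too $z=1/t^2$ is even and $v$, with denominator $t^3$, is odd.
  simp only [F, neg_sq, (show Odd 3 by decide).neg_pow, div_neg]
  exact this

lemma isMeromorphicFunction_eigenvalue (hN : IsLaurentMatrix N)
    (hcomm : ∀ z ≠ 0, Commute (M.P z) (N z)) :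
    IsMeromorphicFunction (M.normalForm (M.eigenvalueFun N)) := by
  have hana : ∀ x, x ≠ M.origin → x ≠ ∞ →
      AnalyticAt ℂ (M.eigenvalueFun N ∘ (M.chart x).symm) (M.chart x x) := by
    intro x h0 h1
    obtain ⟨p, rfl, hz⟩ := exists_of_ne h0 h1
    exact analyticAt_eigenvalueFun hN hz
  refine isMeromorphicFunction_normalForm (fun x => ?_) hana
  by_cases h0 : x = M.origin
  · rw [h0]; exact (eigenvalueFun_origin hN hcomm).1
  by_cases h1 : x = ∞
  · rw [h1]; exact (eigenvalueFun_infty hN hcomm).1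
  exact (hana x h0 h1).meromorphicAt

/-- At a point `(z₀, v₀)` where the conjugate point is not a zero, the eigenvalue has the order of
the determinant. -/
lemma orderAtPoint_eigenvalueFun (hN : IsLaurentMatrix N)
    (hcomm : ∀ z ≠ 0, Commute (M.P z) (N z)) {p : M.Curve} (hz : p.1.1 ≠ 0) (hv : p.1.2 ≠ 0)
    (hne : M.eigenvalue N (p.1.1, -p.1.2) ≠ 0) :
    orderAtPoint (M.eigenvalueFun N) p = meromorphicOrderAt (fun z => (N z).det) p.1.1 := by
  have hφ : M.chart p p = p.1.1 := by
    rw [chart_coe_apply, curveChart, dif_neg hv]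
    rfl
  set v : ℂ → ℂ := fun t => p.1.2 * csqrt (M.cubic t / M.cubic p.1.1)
  have hmem : ∀ t, v t ^ 2 = M.cubic t := M.ordinary_mem p hv
  have hF : M.eigenvalueFun N ∘ (M.chart p).symm = fun t => M.eigenvalue N (t, v t) := by
    ext t
    change M.eigenvalueFun N (((M.curveChart p).symm t : M.Curve) : M.Surface) = _
    rw [eigenvalueFun_coe, curveChart, dif_neg hv]
    rfl
  have hc0 : M.cubic p.1.1 ≠ 0 := by rw [← p.2]; exact pow_ne_zero 2 hv
  have hva : AnalyticAt ℂ v p.1.1 :=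
    analyticAt_const.mul (AnalyticAt.comp (g := csqrt) (csqrt_analyticAt (by
      rw [div_self hc0]; exact one_mem_slitPlane)) (M.analyticAt_cubic _).div_const)
  have hvp : v p.1.1 = p.1.2 := by simp [v, div_self hc0, csqrt_one]
  have h1 := analyticAt_eigenvalue (M := M) hN (z := fun t => t) analyticAt_id hva hz
  have h2 := analyticAt_eigenvalue (M := M) hN (z := fun t => t) analyticAt_id hva.neg hz
  -- The conjugate branch is analytic and nonzero here, so it contributes order $0$ to the
  -- determinant.
  have h3 : meromorphicOrderAt (fun t => M.eigenvalue N (t, (-v) t)) p.1.1 = 0 := by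
    rw [← tendsto_ne_zero_iff_meromorphicOrderAt_eq_zero h2.meromorphicAt]
    refine ⟨_, ?_, h2.continuousAt.tendsto.mono_left nhdsWithin_le_nhds⟩
    rwa [Pi.neg_apply, hvp]
  change meromorphicOrderAt (M.eigenvalueFun N ∘ (M.chart p).symm) (M.chart p p) = _
  rw [hφ, hF, ← add_zero (meromorphicOrderAt _ _), ← h3,
    ← meromorphicOrderAt_mul h1.meromorphicAt h2.meromorphicAt]
  apply meromorphicOrderAt_congr
  filter_upwards [mem_nhdsWithin_of_mem_nhds (isOpen_ne.mem_nhds hz)] with t ht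
  exact M.eigenvalue_mul_neg (p := ⟨(t, v t), hmem t⟩) ht (hcomm t ht)

end eigenvalueFun

variable (M)

/-! ### Orders of the determinants -/

lemma meromorphicOrderAt_const_mul_pow {C : ℂ} (hC : C ≠ 0) {f : ℂ → ℂ} {x : ℂ}
    (hf : MeromorphicAt f x) {n : ℤ} (hn : meromorphicOrderAt f x = n) (k : ℕ) :
    meromorphicOrderAt (fun z => C * f z ^ k) x = (k * n : ℤ) := by
  have h1 := meromorphicOrderAt_mul_of_ne_zero (f := f ^ k) (analyticAt_const (v := C) (x := x)) hC
  have h2 := meromorphicOrderAt_pow hf (n := k)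
  rw [h2, hn] at h1
  refine Eq.trans h1 ?_
  norm_cast

lemma meromorphicOrderAt_one_sub_mul_pow {C : ℂ} (hC : C ≠ 0) (k : ℕ) {c x : ℂ} (hc : c ≠ 0)
    (hx : c * x = 1) :
    meromorphicOrderAt (fun z => C * (1 - c * z) ^ k) x = (k : ℤ) := by
  have hf : AnalyticAt ℂ (fun z => 1 - c * z) x :=
    analyticAt_const.sub (analyticAt_const.mul analyticAt_id)
  rw [← mul_one (k : ℤ)]
  refine meromorphicOrderAt_const_mul_pow hC hf.meromorphicAt ?_ k
  rw [meromorphicOrderAt_eq_int_iff hf.meromorphicAt]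
  refine ⟨fun _ => -c, analyticAt_const, neg_ne_zero.mpr hc, .of_forall fun z => ?_⟩
  simp only [zpow_one, smul_eq_mul]
  linear_combination -hx

lemma meromorphicOrderAt_one_sub_div_pow {C : ℂ} (hC : C ≠ 0) (k : ℕ) {c : ℂ} (hc : c ≠ 0) :
    meromorphicOrderAt (fun z => C * (1 - c / z) ^ k) c = (k : ℤ) := by
  have hf : AnalyticAt ℂ (fun z => 1 - c / z) c :=
    analyticAt_const.sub (analyticAt_const.div analyticAt_id hc)
  rw [← mul_one (k : ℤ)]
  refine meromorphicOrderAt_const_mul_pow hC hf.meromorphicAt ?_ k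
  rw [meromorphicOrderAt_eq_int_iff hf.meromorphicAt]
  refine ⟨fun z => z⁻¹, analyticAt_id.inv hc, inv_ne_zero hc, ?_⟩
  filter_upwards [mem_nhdsWithin_of_mem_nhds (isOpen_ne.mem_nhds hc)] with z hz
  have hz' : z ≠ 0 := hz
  simp only [zpow_one, smul_eq_mul]
  field_simp

lemma meromorphicOrderAt_one_sub_div_sq_pow {C : ℂ} (hC : C ≠ 0) (k : ℕ) {c : ℂ} (hc : c ≠ 0) :
    meromorphicOrderAt (fun t : ℂ => C * (1 - c / t ^ 2) ^ k) 0 = (2 * -k : ℤ) := by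
  have hf : MeromorphicAt (fun t : ℂ => 1 - c / t ^ 2) 0 :=
    (MeromorphicAt.const _ _).sub ((MeromorphicAt.const _ _).div ((MeromorphicAt.id _).pow 2))
  rw [show (2 * -k : ℤ) = k * -2 by ring]
  refine meromorphicOrderAt_const_mul_pow hC hf ?_ k
  rw [meromorphicOrderAt_eq_int_iff hf]
  refine ⟨fun t => t ^ 2 - c, (analyticAt_id.pow 2).sub analyticAt_const, by simpa using hc, ?_⟩
  filter_upwards [self_mem_nhdsWithin] with t ht
  have ht' : t ≠ 0 := ht
  rw [sub_zero, smul_eq_mul, zpow_neg]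
  norm_cast
  field_simp

lemma meromorphicOrderAt_one_sub_mul_sq_pow {C : ℂ} (hC : C ≠ 0) (k : ℕ) (c : ℂ) :
    meromorphicOrderAt (fun t : ℂ => C * (1 - c * t ^ 2) ^ k) 0 = (2 * 0 : ℤ) := by
  have hf : AnalyticAt ℂ (fun t : ℂ => 1 - c * t ^ 2) 0 :=
    analyticAt_const.sub (analyticAt_const.mul (analyticAt_id.pow 2))
  rw [show (2 * 0 : ℤ) = k * 0 by ring]
  refine meromorphicOrderAt_const_mul_pow hC hf.meromorphicAt ?_ k
  exact (tendsto_ne_zero_iff_meromorphicOrderAt_eq_zero hf.meromorphicAt).mp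
    ⟨_, by simp, hf.continuousAt.tendsto.mono_left nhdsWithin_le_nhds⟩

/-! ### The points where `λ` vanishes -/

lemma T_pos : 0 < M.T := by
  have := M.α_pos
  unfold T
  positivity

lemma T_ne_zero : (M.T : ℂ) ≠ 0 := by exact_mod_cast M.T_pos.ne'

lemma R_of_mul_eq_zero {z : ℂ} (h : (1 - M.a ^ 2 * z) * (1 - M.a ^ 2 / z) = 0) :
    M.R z = (M.T : ℂ) ^ 2 := by
  unfold R T
  push_cast
  linear_combination (-4) * h

lemma sqrtR_of_mul_eq_zero {z : ℂ} (h : (1 - M.a ^ 2 * z) * (1 - M.a ^ 2 / z) = 0) :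
    M.sqrtR z = M.T :=
  -- The trace is positive, so it is the principal root of its square.
  (csqrt_eq (by simpa using M.T_pos) (M.R_of_mul_eq_zero h).symm).2

/-- Among the points over a zero of `det P`, only the one on the second sheet is a zero of `λ`. -/
lemma lam_eq_T {p : M.Curve} (hz : p.1.1 ≠ 0)
    (h : (1 - M.a ^ 2 * p.1.1) * (1 - M.a ^ 2 / p.1.1) = 0)
    (hp : (p : M.Surface) ≠ M.sheet₂ p.1.1) : M.lam p = M.T := by
  have h1 := p.2
  rw [M.cubic_eq_sq_mul_R _ hz, M.R_of_mul_eq_zero h] at h1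
  have h2 : (p.1.2 - p.1.1 * M.T) * (p.1.2 + p.1.1 * M.T) = 0 := by linear_combination h1
  rw [M.lam_coe hz]
  rcases mul_eq_zero.mp h2 with h3 | h3
  · rw [sub_eq_zero.mp h3]
    field_simp
    ring
  · refine absurd ?_ hp
    refine congrArg _ (Subtype.ext (Prod.ext rfl ?_))
    change p.1.2 = -(p.1.1 * M.sqrtR p.1.1)
    rw [M.sqrtR_of_mul_eq_zero h]
    linear_combination h3

/-! ### Zeros of the eigenvalue of one factor -/

section factor

variable {M} {N N' : ℂ → Matrix (Fin 2) (Fin 2) ℂ} {k : ℕ} {z₀ : ℂ}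

/-- Zeros of the eigenvalue of a factor `N` of a power of `P`. -/
lemma eigenvalue_ne_zero (hcomm : ∀ z ≠ 0, Commute (M.P z) (N z))
    (hlam : ∀ p : M.Curve, p.1.1 ≠ 0 →
      M.lam p ^ k = M.eigenvalue N p.1 * M.eigenvalue N' p.1)
    (h₀ : (1 - M.a ^ 2 * z₀) * (1 - M.a ^ 2 / z₀) = 0)
    (hdet : ∀ z ≠ 0, z ≠ z₀ → (N z).det ≠ 0)
    {p : M.Curve} (hz : p.1.1 ≠ 0) (hp : (p : M.Surface) ≠ M.sheet₂ z₀) :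
    M.eigenvalue N p.1 ≠ 0 := by
  intro h
  by_cases hz₀ : p.1.1 = z₀
  -- Over $z_0$ but off the second sheet, $\lambda$ is the nonzero trace, so no factor of
  -- $\lambda^k$ can vanish.
  · have h1 := hlam p hz
    rw [M.lam_eq_T hz (by rw [hz₀]; exact h₀) (by rwa [hz₀]), h, zero_mul] at h1
    exact pow_ne_zero k M.T_ne_zero h1
  · apply hdet _ hz hz₀
    rw [← M.eigenvalue_mul_neg hz (hcomm _ hz), h, zero_mul]

/-- The conjugate of this point lies on the first sheet, where the eigenvalue is nonzero, so the
full order of the determinant is found here. Only the determinant of the single factor is used, so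
the case $a=1$, where $a^2=a^{-2}$, needs no separate treatment. -/
lemma orderAtPoint_sheet₂ (hN : IsLaurentMatrix N) (hcomm : ∀ z ≠ 0, Commute (M.P z) (N z))
    (hlam : ∀ p : M.Curve, p.1.1 ≠ 0 →
      M.lam p ^ k = M.eigenvalue N p.1 * M.eigenvalue N' p.1) (hz₀ : z₀ ≠ 0)
    (h₀ : (1 - M.a ^ 2 * z₀) * (1 - M.a ^ 2 / z₀) = 0)
    (hdet : ∀ z ≠ 0, z ≠ z₀ → (N z).det ≠ 0) :
    orderAtPoint (M.normalForm (M.eigenvalueFun N)) (M.sheet₂ z₀) =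
      meromorphicOrderAt (fun z => (N z).det) z₀ := by
  have hv : z₀ * M.sqrtR z₀ ≠ 0 := by
    rw [M.sqrtR_of_mul_eq_zero h₀]
    exact mul_ne_zero hz₀ M.T_ne_zero
  rw [orderAtPoint_normalForm]
  refine orderAtPoint_eigenvalueFun hN hcomm (p := ⟨(z₀, -(z₀ * M.sqrtR z₀)), _⟩) hz₀
    (neg_ne_zero.mpr hv) ?_
  refine eigenvalue_ne_zero (p := ⟨(z₀, - -(z₀ * M.sqrtR z₀)), ?_⟩) hcomm hlam h₀ hdet
    hz₀ ?_
  · rw [neg_neg]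
    exact M.sheet_mem z₀
  · intro h
    have h1 := congrArg (fun q : M.Curve => q.1.2) (OnePoint.coe_injective h)
    simp only [neg_neg] at h1
    exact hv (self_eq_neg.mp h1)

lemma orderAtPoint_eq_zero (hN : IsLaurentMatrix N) (hcomm : ∀ z ≠ 0, Commute (M.P z) (N z))
    (hlam : ∀ p : M.Curve, p.1.1 ≠ 0 →
      M.lam p ^ k = M.eigenvalue N p.1 * M.eigenvalue N' p.1)
    (h₀ : (1 - M.a ^ 2 * z₀) * (1 - M.a ^ 2 / z₀) = 0)
    (hdet : ∀ z ≠ 0, z ≠ z₀ → (N z).det ≠ 0) {x : M.Surface} (hx : x ≠ M.sheet₂ z₀)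
    (hx0 : x ≠ M.origin) (hx1 : x ≠ ∞) :
    orderAtPoint (M.normalForm (M.eigenvalueFun N)) x = 0 := by
  obtain ⟨p, rfl, hz⟩ := exists_of_ne hx0 hx1
  rw [orderAtPoint_normalForm]
  exact orderAtPoint_eigenvalueFun_eq_zero hN hz
    (eigenvalue_ne_zero hcomm hlam h₀ hdet hz hx)

lemma normalForm_eigenvalueFun {p : M.Curve} (hz : p.1.1 ≠ 0) :
    M.normalForm (M.eigenvalueFun N) p = M.eigenvalue N p.1 :=
  normalForm_of_ne (coe_ne_origin hz) (OnePoint.coe_ne_infty p)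

end factor

/-! ### Diagonalization -/

lemma ne_zero_of_mem_slitDomain {z : ℂ} (hz : z ∈ M.slitDomain) : z ≠ 0 := by
  rintro rfl
  exact hz ⟨0, Or.inr ⟨M.x₂_neg.le, le_rfl⟩, by simp⟩

/-- The determinant is $-a\alpha(1+z)R(z)^{1/2}$, and $R$ has no zero off the cuts. -/
lemma isUnit_det_E {z : ℂ} (hz : z ∈ M.slitDomain) (h1 : z ≠ -1) : IsUnit (M.E z).det := by
  have h0 := M.ne_zero_of_mem_slitDomain hz
  have ha : (M.a : ℂ) ≠ 0 := by exact_mod_cast M.a_pos.ne'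
  have hα : (M.α : ℂ) ≠ 0 := by exact_mod_cast M.α_pos.ne'
  have hR : M.sqrtR z ≠ 0 := csqrt_ne_zero (slitPlane_ne_zero (M.R_mem_slitPlane hz))
  have h2 : 1 + z ≠ 0 := fun h => h1 (by linear_combination h)
  have h3 : (M.E z).det = -(M.a * M.α * (1 + z) * M.sqrtR z) := by
    rw [E, Matrix.det_fin_two_of, sheet₁, sheet₂, M.lam_coe h0, M.lam_coe h0]
    field_simp
    ring
  rw [isUnit_iff_ne_zero, h3]
  exact neg_ne_zero.mpr (mul_ne_zero (mul_ne_zero (mul_ne_zero ha hα) h2) hR)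

/-- The vector is $(P_{01},\lambda-P_{00})$: the first row is then automatic, and the second is the
characteristic equation. -/
lemma P_mulVec {p : M.Curve} (hz : p.1.1 ≠ 0) :
    (M.P p.1.1).mulVec ![M.a * M.α * (1 + p.1.1), M.lam p - M.α * (M.a ^ 2 + 1)] =
      M.lam p • ![M.a * M.α * (1 + p.1.1), M.lam p - M.α * (M.a ^ 2 + 1)] := by
  have hα : (M.α : ℂ) ≠ 0 := by exact_mod_cast M.α_pos.ne'
  have h := M.lam_char hz
  have hT : (M.T : ℂ) = 2 * (M.α * (M.a ^ 2 + 1)) + M.diagDiff := by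
    unfold T diagDiff; push_cast; ring
  have h2 : M.a / M.α * (1 + 1 / p.1.1) * (M.a * M.α * (1 + p.1.1)) = (M.α * (M.a ^ 2 + 1)) *
      (M.α * (M.a ^ 2 + 1) + M.diagDiff) - (1 - M.a ^ 2 * p.1.1) * (1 - M.a ^ 2 / p.1.1) := by
    unfold diagDiff
    field_simp
    ring
  rw [hT] at h
  rw [M.P_apply _ hz]
  ext i
  fin_cases i
  · simp [Matrix.mulVec, dotProduct, Fin.sum_univ_two]
    ring
  · simp only [Fin.mk_one, Matrix.mulVec, dotProduct, Fin.sum_univ_two, Matrix.of_apply,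
      Matrix.cons_val', Matrix.cons_val_zero, Matrix.cons_val_one, Matrix.cons_val_fin_one,
      Pi.smul_apply, smul_eq_mul]
    linear_combination h2 - h

lemma eq_conj {z : ℂ} (hz : z ∈ M.slitDomain) (h1 : z ≠ -1) {A : Matrix (Fin 2) (Fin 2) ℂ}
    {c₁ c₂ : ℂ}
    (h₁ : A.mulVec ![M.a * M.α * (1 + z), M.lam (M.sheet₁ z) - M.α * (M.a ^ 2 + 1)] =
      c₁ • ![M.a * M.α * (1 + z), M.lam (M.sheet₁ z) - M.α * (M.a ^ 2 + 1)])
    (h₂ : A.mulVec ![M.a * M.α * (1 + z), M.lam (M.sheet₂ z) - M.α * (M.a ^ 2 + 1)] =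
      c₂ • ![M.a * M.α * (1 + z), M.lam (M.sheet₂ z) - M.α * (M.a ^ 2 + 1)]) :
    A = M.E z * !![c₁, 0; 0, c₂] * (M.E z)⁻¹ := by
  have hE : A * M.E z = M.E z * !![c₁, 0; 0, c₂] := by
    have h₁' := fun i => congrFun h₁ i
    have h₂' := fun i => congrFun h₂ i
    simp only [Matrix.mulVec, dotProduct, Fin.sum_univ_two, Matrix.cons_val_zero,
      Matrix.cons_val_one, Pi.smul_apply, smul_eq_mul] at h₁' h₂'
    ext i j
    fin_cases j
    · simp only [E, Matrix.mul_apply, Fin.sum_univ_two]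
      refine (h₁' i).trans ?_
      fin_cases i <;> simp [mul_comm]
    · simp only [E, Matrix.mul_apply, Fin.sum_univ_two]
      refine (h₂' i).trans ?_
      fin_cases i <;> simp [mul_comm]
  rw [← hE, mul_assoc, Matrix.mul_nonsing_inv _ (M.isUnit_det_E hz h1), mul_one]

/-- The columns of $E$ depend on $P$ alone, so one matrix diagonalizes everything that commutes with
$P$. -/
lemma eq_conj_of_commute {N : ℂ → Matrix (Fin 2) (Fin 2) ℂ}
    (hcomm : ∀ z ≠ 0, Commute (M.P z) (N z)) {z : ℂ} (hz : z ∈ M.slitDomain) (h1 : z ≠ -1) :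
    N z = M.E z * !![M.normalForm (M.eigenvalueFun N) (M.sheet₁ z), 0;
      0, M.normalForm (M.eigenvalueFun N) (M.sheet₂ z)] * (M.E z)⁻¹ := by
  have h0 := M.ne_zero_of_mem_slitDomain hz
  have key : ∀ p : M.Curve, p.1.1 = z →
      (N z).mulVec ![M.a * M.α * (1 + z), M.lam p - M.α * (M.a ^ 2 + 1)] =
      M.normalForm (M.eigenvalueFun N) p •
        ![M.a * M.α * (1 + z), M.lam p - M.α * (M.a ^ 2 + 1)] := by
    rintro p rfl
    rw [normalForm_eigenvalueFun h0]
    exact M.mulVec_of_commute h0 (hcomm _ h0) (M.P_mulVec h0)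
  exact M.eq_conj hz h1 (key _ rfl) (key _ rfl)

end

end AztecParams

open AztecParams in
theorem lemma3p2 (M : AztecParams) (d : ℕ) (hd : 0 < d) (horder : addOrderOf M.shiftPoint = d) :
    ∃ μ ν : M.Surface → ℂ,
      -- the two spectral curves define meromorphic functions on the Riemann surface
      IsMeromorphicFunction μ ∧ IsMeromorphicFunction ν ∧
      (∀ p : M.Curve, p.1.1 ≠ 0 →
        (M.Pminus d p.1.1 - μ p • (1 : Matrix (Fin 2) (Fin 2) ℂ)).det = 0 ∧
        (M.Pplus d p.1.1 - ν p • (1 : Matrix (Fin 2) (Fin 2) ℂ)).det = 0 ∧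
        M.lam p ^ d = μ p * ν p) ∧
      -- zeros and poles of `μ`
      orderAtPoint μ (M.sheet₂ (M.a ^ 2)) = (d : ℤ) ∧
      orderAtPoint μ M.origin = (-d : ℤ) ∧
      (∀ p : M.Surface, p ≠ M.sheet₂ (M.a ^ 2) → p ≠ M.origin → orderAtPoint μ p = 0) ∧
      -- zeros and poles of `ν`
      orderAtPoint ν (M.sheet₂ (1 / M.a ^ 2)) = (d : ℤ) ∧
      orderAtPoint ν OnePoint.infty = (-d : ℤ) ∧
      (∀ p : M.Surface, p ≠ M.sheet₂ (1 / M.a ^ 2) → p ≠ OnePoint.infty →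
        orderAtPoint ν p = 0) ∧
      -- simultaneous diagonalization
      (∀ z ∈ M.slitDomain, z ≠ -1 →
        IsUnit (M.E z).det ∧
        M.P z = M.E z * !![M.lam (M.sheet₁ z), 0; 0, M.lam (M.sheet₂ z)] * (M.E z)⁻¹ ∧
        M.Pminus d z = M.E z * !![μ (M.sheet₁ z), 0; 0, μ (M.sheet₂ z)] * (M.E z)⁻¹ ∧
        M.Pplus d z = M.E z * !![ν (M.sheet₁ z), 0; 0, ν (M.sheet₂ z)] * (M.E z)⁻¹) := by
  subst horder
  set d := addOrderOf M.shiftPoint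
  have ha : (M.a : ℂ) ≠ 0 := by exact_mod_cast M.a_pos.ne'
  have ha2 : (M.a : ℂ) ^ 2 ≠ 0 := pow_ne_zero 2 ha
  have hcm : ∀ z ≠ 0, Commute (M.P z) (M.Pminus d z) := fun z hz => M.commute_Pminus hz
  have hcp : ∀ z ≠ 0, Commute (M.P z) (M.Pplus d z) := fun z hz => M.commute_Pplus hz
  have hLm := M.isLaurentMatrix_Pminus d
  have hLp := M.isLaurentMatrix_Pplus d
  have hlam : ∀ p : M.Curve, p.1.1 ≠ 0 → M.lam p ^ d =
      M.eigenvalue (M.Pminus d) p.1 * M.eigenvalue (M.Pplus d) p.1 := fun p hz =>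
    M.lam_pow_eq hz (hcm _ hz) (hcp _ hz) (M.P_pow d hz)
  -- The factorization lemmas treat the first factor; the swapped form serves for $\nu$.
  have hlam' : ∀ p : M.Curve, p.1.1 ≠ 0 → M.lam p ^ d =
      M.eigenvalue (M.Pplus d) p.1 * M.eigenvalue (M.Pminus d) p.1 := fun p hz => by
    rw [hlam p hz, mul_comm]
  obtain ⟨C, hC, hdetm⟩ := M.det_Pminus d
  obtain ⟨D, hD, hdetp⟩ := M.det_Pplus d
  have hm0 : (1 - (M.a : ℂ) ^ 2 * M.a ^ 2) * (1 - M.a ^ 2 / M.a ^ 2) = 0 := by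
    rw [div_self ha2]; ring
  have hp0 : (1 - (M.a : ℂ) ^ 2 * (1 / M.a ^ 2)) * (1 - M.a ^ 2 / (1 / M.a ^ 2)) = 0 := by
    rw [mul_one_div_cancel ha2]; ring
  have hm1 : ∀ z ≠ 0, z ≠ (M.a : ℂ) ^ 2 → (M.Pminus d z).det ≠ 0 := by
    intro z hz hne
    rw [hdetm]
    refine mul_ne_zero hC (pow_ne_zero d fun h => hne ?_)
    field_simp at h
    linear_combination h
  have hp1 : ∀ z ≠ 0, z ≠ 1 / (M.a : ℂ) ^ 2 → (M.Pplus d z).det ≠ 0 := by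
    intro z _ hne
    rw [hdetp]
    refine mul_ne_zero hD (pow_ne_zero d fun h => hne ?_)
    rw [eq_div_iff ha2]
    linear_combination -h
  have hq := quot_zero_ne_zero (M := M)
  have hmo : orderAtPoint (M.normalForm (M.eigenvalueFun (M.Pminus d))) M.origin = (-d : ℤ) := by
    rw [orderAtPoint_normalForm]
    refine (eigenvalueFun_origin hLm hcm).2 _ ?_
    -- With $z=t^2/q$ the determinant has a pole of order $2d$ in $t$, twice the pole order of
    -- $\mu$.
    have h1 : (fun t : ℂ => (M.Pminus d (t ^ 2 / M.quot 0 0)).det) =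
        fun t => C * (1 - M.a ^ 2 * M.quot 0 0 / t ^ 2) ^ d := by
      ext t
      rw [hdetm, div_div_eq_mul_div]
    rw [h1, meromorphicOrderAt_one_sub_div_sq_pow hC d (mul_ne_zero ha2 hq)]
  -- The determinant of $P_-^{(d)}$ tends to a nonzero constant at infinity, so $\mu$ has neither
  -- zero nor pole there.
  have hmi : orderAtPoint (M.normalForm (M.eigenvalueFun (M.Pminus d))) OnePoint.infty = 0 := by
    rw [orderAtPoint_normalForm]
    refine (eigenvalueFun_infty hLm hcm).2 0 ?_
    have h1 : (fun t : ℂ => (M.Pminus d (1 / t ^ 2)).det) =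
        fun t => C * (1 - M.a ^ 2 * t ^ 2) ^ d := by
      ext t
      rw [hdetm, div_div_eq_mul_div, div_one]
    rw [h1, meromorphicOrderAt_one_sub_mul_sq_pow hC d]
  have hpi : orderAtPoint (M.normalForm (M.eigenvalueFun (M.Pplus d))) OnePoint.infty =
      (-d : ℤ) := by
    rw [orderAtPoint_normalForm]
    refine (eigenvalueFun_infty hLp hcp).2 _ ?_
    have h1 : (fun t : ℂ => (M.Pplus d (1 / t ^ 2)).det) =
        fun t => D * (1 - M.a ^ 2 / t ^ 2) ^ d := by
      ext t
      rw [hdetp, mul_one_div]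
    rw [h1, meromorphicOrderAt_one_sub_div_sq_pow hD d ha2]
  have hpo : orderAtPoint (M.normalForm (M.eigenvalueFun (M.Pplus d))) M.origin = 0 := by
    rw [orderAtPoint_normalForm]
    refine (eigenvalueFun_origin hLp hcp).2 0 ?_
    have h1 : (fun t : ℂ => (M.Pplus d (t ^ 2 / M.quot 0 0)).det) =
        fun t => D * (1 - M.a ^ 2 / M.quot 0 0 * t ^ 2) ^ d := by
      ext t
      rw [hdetp, mul_div_assoc', div_mul_eq_mul_div]
    rw [h1, meromorphicOrderAt_one_sub_mul_sq_pow hD d]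
  refine ⟨M.normalForm (M.eigenvalueFun (M.Pminus d)), M.normalForm (M.eigenvalueFun (M.Pplus d)),
    isMeromorphicFunction_eigenvalue hLm hcm, isMeromorphicFunction_eigenvalue hLp hcp,
    fun p hz => ?_, ?_, hmo, fun p hp hp' => ?_, ?_, hpi, fun p hp hp' => ?_, fun z hz hz1 => ?_⟩
  · rw [normalForm_eigenvalueFun hz, normalForm_eigenvalueFun hz]
    exact ⟨M.det_sub_eigenvalue hz (hcm _ hz), M.det_sub_eigenvalue hz (hcp _ hz), hlam p hz⟩
  · rw [orderAtPoint_sheet₂ hLm hcm hlam ha2 hm0 hm1]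
    simp only [hdetm]
    rw [meromorphicOrderAt_one_sub_div_pow hC d ha2]
  · by_cases hi : p = OnePoint.infty
    · rw [hi, hmi]
    · exact orderAtPoint_eq_zero hLm hcm hlam hm0 hm1 hp hp' hi
  · rw [orderAtPoint_sheet₂ hLp hcp hlam' (one_div_ne_zero ha2) hp0 hp1]
    simp only [hdetp]
    rw [meromorphicOrderAt_one_sub_mul_pow hD d ha2 (mul_one_div_cancel ha2)]
  · by_cases hi : p = M.origin
    · rw [hi, hpo]
    · exact orderAtPoint_eq_zero hLp hcp hlam' hp0 hp1 hp hi hp'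
  · have h0 := M.ne_zero_of_mem_slitDomain hz
    refine ⟨M.isUnit_det_E hz hz1, ?_, M.eq_conj_of_commute hcm hz hz1,
      M.eq_conj_of_commute hcp hz hz1⟩
    have key : ∀ p : M.Curve, p.1.1 = z →
        (M.P z).mulVec ![M.a * M.α * (1 + z), M.lam p - M.α * (M.a ^ 2 + 1)] =
        M.lam p • ![M.a * M.α * (1 + z), M.lam p - M.α * (M.a ^ 2 + 1)] := by
      rintro p rfl
      exact M.P_mulVec h0
    exact M.eq_conj hz hz1 (key _ rfl) (key _ rfl)
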